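/- **Setting.** Let $a>0$, $D_h\ge 2a$, $n_0>0$, $\Delta n>0$, $\lambda>0$, put $k=\frac{2\pi}{\lambda}n_0$, and let $0<\beta_0<k\Delta n/n_0$. Put $$\Lambda=\sqrt{\tfrac{2k^2\Delta n}{n_0}-2k\beta_0},\qquad \Gamma=\sqrt{2k\beta_0},$$ and assume the characteristic equation $$\frac{\Lambda J_1(\Lambda a)}{J_0(\Lambda a)}=\frac{\Gamma K_1(\Gamma a)}{K_0(\Gamma a)},$$ where $J_n$ is the Bessel function of the first kind and $I_n$, $K_n$ are the modified Bessel functions of the first and second kind. Let $$A=\Big[\pi a^2\big(J_1^2(\Lambda a)+J_0^2(\Lambda a)\big)+\pi a^2\Big(\tfrac{J_0(\Lambda a)}{K_0(\Gamma a)}\Big)^2\big(K_1^2(\Gamma a)-K_0^2(\Gamma a)\big)\Big]^{-1/2},\qquad B=A\,\frac{J_0(\Lambda a)}{K_0(\Gamma a)}$$ (the normalization constants), let $\phi(r)=AJ_0(\Lambda r)$ for $0\le r<a$ and $\phi(r)=BK_0(\Gamma r)$ for $r\ge a$, and for $m\in\mathbb Z$ let $\phi_m(x,y)=\phi\big(\sqrt{(x-mD_h)^2+y^2}\big)$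 be the mode of the $m$-th waveguide. Let $\Delta n_m=\Delta n$ on the open disk $B_a(mD_h,0)$ and $\Delta n_m=0$ elsewhere. The coupling coefficients of the infinite array are $$\kappa_{ij}=\iint_{\mathbb R^2}\phi_i\Big(\sum_{l\in\mathbb Z,\,l\ne j}\frac{k\,\Delta n_l}{n_0}\Big)\phi_j\,dx\,dy,\qquad i,j\in\mathbb Z.$$ For integers $l,s$ with $l\neq0$, $l\ne s$ and integers $m\ge0$ put $$T^{l,s}_m=K_m(\Gamma|l|D_h)\,K_m(\Gamma|l-s|D_h)\int_0^aI_m^2(\Gamma r)\,r\,dr,$$ and define $$\varsigma_{l,s}=T_0^{l,s}+2\sum_{m=1}^\infty T_m^{l,s}\ \ (l(l-s)>0),\qquad \zeta_{l,s}=T_0^{l,s}+2\sum_{m=1}^\infty(-1)^mT_m^{l,s}\ \ (0<l<s),$$ $$\tau_s=K_0(\Gamma sD_h)\int_0^aJ_0(\Lambda r)I_0(\Gamma r)\,r\,dr\ \ (s>0).$$ **Theorem.** 1. For all integers $l,s$ with $l\ne0$, $l\neq s$, the number $q=\dfrac{a^2}{|l(l-s)|D_h^2}$ satisfies $q<1$,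 and $|T_m^{l,s}|\le \dfrac{e^{2\Gamma a}a^2}{8}\,\dfrac{q^m}{m^2}$ for all $m\ge1$. In particular the series $\sum_{m\ge1}T^{l,s}_m$ and $\sum_{m\ge1}(-1)^mT^{l,s}_m$ converge absolutely. 2. For every integer $s\ge0$ the series $\sum_{l\le-1}\varsigma_{l,s}$ and $\sum_{l\ge s+1}\varsigma_{l,s}$ converge absolutely. 3. For all $i,j\in\mathbb Z$ the integrand defining $\kappa_{ij}$ is integrable on $\mathbb{R}^2$, and $\kappa_{ij}=\kappa_s$ depends only on $s=|i-j|$, where $$\kappa_s=\begin{cases}\dfrac{2\pi k\Delta n}{n_0}\Big(B^2\displaystyle\sum_{l=-\infty}^{-1}\varsigma_{l,s}+AB\,\tau_s+B^2\sum_{l=1}^{s-1}\zeta_{l,s}+B^2\sum_{l=s+1}^{\infty}\varsigma_{l,s}\Big),& s>0,\\[2ex]\dfrac{2\pi B^2k\Delta n}{n_0}\Big(\displaystyle\sum_{l=-\infty}^{-1}\varsigma_{l,0}+\sum_{l=1}^{\infty}\varsigma_{l,0}\Big),& s=0.\end{cases}$$ -/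

import Mathlib

noncomputable section

namespace Waveguide

/-- Bessel function of the first kind `J_n`, of order `n ∈ ℕ`, by its power series. -/
def besselJ (n : ℕ) (x : ℝ) : ℝ :=
  ∑' k : ℕ, (-1 : ℝ) ^ k / ((k.factorial : ℝ) * ((k + n).factorial : ℝ)) * (x / 2) ^ (2 * k + n)

/-- Modified Bessel function of the first kind `I_n`, of order `n ∈ ℕ`, by its power series. -/
def besselI (n : ℕ) (x : ℝ) : ℝ :=
  ∑' k : ℕ, 1 / ((k.factorial : ℝ) * ((k + n).factorial : ℝ)) * (x / 2) ^ (2 * k + n)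

/-- Modified Bessel function of the second kind `K_n`, of order `n ∈ ℕ`, for `x > 0`:
`K_n(x) = ∫_0^∞ exp(-x cosh t) cosh(n t) dt`. -/
def besselK (n : ℕ) (x : ℝ) : ℝ :=
  ∫ t in Set.Ioi (0 : ℝ), Real.exp (-x * Real.cosh t) * Real.cosh ((n : ℝ) * t)

/-- The numerical data of the infinite horizontal array of identical step-index waveguides:
core `m ∈ ℤ` is the disk of radius `a` about `(m D_h, 0)`. -/
structure ArrayData where
  /-- core radius -/
  a : ℝ
  /-- centre-to-centre spacing `D_h` -/
  D : ℝ
  /-- background refractive index `n_0` -/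
  n0 : ℝ
  /-- index contrast `Δn` -/
  dn : ℝ
  /-- vacuum wavelength `λ` -/
  wl : ℝ
  /-- longitudinal wavenumber shift `β_0` of a single guide -/
  beta0 : ℝ

namespace ArrayData

variable (P : ArrayData)

/-- Background wavenumber `k = 2π n_0 / λ`. -/
def k : ℝ := 2 * Real.pi / P.wl * P.n0

/-- `Λ = √(2k²Δn/n_0 - 2kβ_0)`. -/
def Lam : ℝ := √(2 * P.k ^ 2 * P.dn / P.n0 - 2 * P.k * P.beta0)

/-- `Γ = √(2kβ_0)`. -/
def Gam : ℝ := √(2 * P.k * P.beta0)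

/-- The characteristic equation `Λ J_1(Λa) / J_0(Λa) = Γ K_1(Γa) / K_0(Γa)`. -/
def CharacteristicEq : Prop :=
  P.Lam * besselJ 1 (P.Lam * P.a) / besselJ 0 (P.Lam * P.a) =
    P.Gam * besselK 1 (P.Gam * P.a) / besselK 0 (P.Gam * P.a)

/-- The amplitude `A` of the normalized mode inside the core. -/
def A : ℝ :=
  (Real.pi * P.a ^ 2 * (besselJ 1 (P.Lam * P.a) ^ 2 + besselJ 0 (P.Lam * P.a) ^ 2) +
    Real.pi * P.a ^ 2 * (besselJ 0 (P.Lam * P.a) / besselK 0 (P.Gam * P.a)) ^ 2 *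
      (besselK 1 (P.Gam * P.a) ^ 2 - besselK 0 (P.Gam * P.a) ^ 2)) ^ (-(1 / 2) : ℝ)

/-- The amplitude `B` of the normalized mode outside the core. -/
def B : ℝ := P.A * (besselJ 0 (P.Lam * P.a) / besselK 0 (P.Gam * P.a))

/-- Distance from `p` to the centre `(m D_h, 0)` of core `m`. -/
def dist (m : ℤ) (p : ℝ × ℝ) : ℝ := √((p.1 - (m : ℝ) * P.D) ^ 2 + p.2 ^ 2)

/-- The radial profile `φ(r)` of the transverse mode of a single guide. -/
def radialMode (r : ℝ) : ℝ :=
  if r < P.a then P.A * besselJ 0 (P.Lam * r) else P.B * besselK 0 (P.Gam * r)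

/-- The mode `φ_m` of core `m`: the mode of core `0` translated by `m D_h`. -/
def mode (m : ℤ) (p : ℝ × ℝ) : ℝ := P.radialMode (P.dist m p)

/-- The index perturbation `Δn_m` of core `m`. -/
def indexPert (m : ℤ) (p : ℝ × ℝ) : ℝ := if P.dist m p < P.a then P.dn else 0

/-- The integrand `φ_i · (∑_{l ≠ j} k Δn_l / n_0) · φ_j` of the coupling coefficient; the sum
over `l ∈ ℤ` has finitely many nonzero terms at every point when `D_h ≠ 0`. -/
def kappaIntegrand (i j : ℤ) (p : ℝ × ℝ) : ℝ :=
  P.mode i p * (∑' l : {l : ℤ // l ≠ j}, P.k * P.indexPert l p / P.n0) * P.mode j p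

/-- The coupling coefficient `κ_{ij}` of the infinite array. -/
def kappa (i j : ℤ) : ℝ := ∫ p : ℝ × ℝ, P.kappaIntegrand i j p

/-- `K_m(Γ|l|D_h) K_m(Γ|l-s|D_h) ∫_0^a I_m(Γr)² r dr`. -/
def term (l s : ℤ) (m : ℕ) : ℝ :=
  besselK m (P.Gam * |(l : ℝ)| * P.D) * besselK m (P.Gam * |(l : ℝ) - (s : ℝ)| * P.D) *
    ∫ r in (0 : ℝ)..P.a, besselI m (P.Gam * r) ^ 2 * r

/-- `ς_{l,s}`, used for `l (l - s) > 0`. -/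
def varsigma (l s : ℤ) : ℝ := P.term l s 0 + 2 * ∑' m : ℕ, P.term l s (m + 1)

/-- `ζ_{l,s}`, used for `0 < l < s`. -/
def zeta (l s : ℤ) : ℝ :=
  P.term l s 0 + 2 * ∑' m : ℕ, (-1 : ℝ) ^ (m + 1) * P.term l s (m + 1)

/-- `τ_s`, used for `s > 0`. -/
def tau (s : ℤ) : ℝ :=
  besselK 0 (P.Gam * (s : ℝ) * P.D) *
    ∫ r in (0 : ℝ)..P.a, besselJ 0 (P.Lam * r) * besselI 0 (P.Gam * r) * r

end ArrayData

end Waveguide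

end

namespace Waveguide

open MeasureTheory Set Filter Topology

/-! ### Bessel functions `J` and `I` -/

/-! The index perturbation lives on the cores, so `kappa i j` is a sum over `l ≠ j` of integrals
over the disk of core `l`. Since `D ≥ 2a`, every mode other than the `l`-th is in its cladding
regime `B K_0(Γ|p - c|)` on that disk. Graf's addition theorem expands it about the centre of core
`l` as a cosine series with coefficients `I_n(Γr) K_n(Γd)`, times `(-1)^n` when the mode's centre
lies on the negative side. Parseval on each circle and integration over `r` turn a product of two
such fields into `2π (T_0 + 2 ∑ σ^n T_n)`, with `σ = 1` when both centres lie on the same side of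
core `l` (giving ς) and `σ = -1` when core `l` lies between them (giving ζ). For `l = i` the field
of mode `i` is the radial `A J_0(Λr)`, so only the circular mean of the other field survives, which
gives τ.

Graf's theorem (`hasSum_besselI_mul_besselK_mul_cos`) comes from two facts. Rotating the contour in
the integral for `K_0` gives `K_0(√(X² + Y²)) = ∫ exp(-X cosh t) cos(Y sinh t) dt` for `X > 0`
(`besselK_zero_sqrt`). The generating function of the `I_n` expands the part of this integrand
depending on `r` and `θ`, and the series is integrated termwise against `exp(-d cosh t)`.

Convergence rests on `K_{n+1}(x) ≤ (2/x)^{n+1} n!/2` and `I_n(x) ≤ (x/2)^n e^x / n!` for `x > 0`.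
Together they bound `T_n` by `q^n / n²` and each overlap sum by a constant times `1/|l(l - s)|`,
which is summable over the cores and justifies exchanging sum and integral. -/

/-- From `n! k! ≤ (k+n)!` and `(2k)! ≤ 4^k (k!)²`. The majorant is a multiple of the cosh series, so
one estimate yields both convergence and exponential growth bounds for `I_n` and `J_n`. -/
lemma bessel_coeff_le (n k : ℕ) (x : ℝ) :
    |1 / ((k.factorial : ℝ) * ((k + n).factorial : ℝ)) * (x / 2) ^ (2 * k + n)| ≤
      (|x| / 2) ^ n / n.factorial * (|x| ^ (2 * k) / ((2 * k).factorial : ℝ)) := by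
  have h1 : (n.factorial : ℝ) * k.factorial ≤ (k + n).factorial := by
    have := Nat.le_of_dvd (Nat.factorial_pos _) (Nat.factorial_mul_factorial_dvd_factorial_add k n)
    rw [mul_comm] at this
    exact_mod_cast this
  have h2 : ((2 * k).factorial : ℝ) ≤ 2 ^ (2 * k) * (k.factorial * k.factorial) := by
    have h3 := Nat.choose_mul_factorial_mul_factorial (show k ≤ 2 * k by omega)
    rw [show 2 * k - k = k by omega] at h3
    have h4 := Nat.choose_le_two_pow (2 * k) k
    rw [mul_assoc] at h3
    have : (2 * k).factorial ≤ 2 ^ (2 * k) * (k.factorial * k.factorial) := by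
      rw [← h3]; gcongr
    exact_mod_cast this
  have e : |1 / ((k.factorial : ℝ) * ((k + n).factorial : ℝ)) * (x / 2) ^ (2 * k + n)| =
      (|x| / 2) ^ n * |x| ^ (2 * k) *
        (1 / (2 ^ (2 * k) * (k.factorial * (k + n).factorial))) := by
    rw [abs_mul, abs_pow, abs_div, abs_div, abs_of_pos (show (0 : ℝ) < 2 by norm_num),
      abs_of_pos (show (0 : ℝ) < (k.factorial : ℝ) * ((k + n).factorial : ℝ) by positivity),
      abs_one, pow_add, div_pow |x| 2 (2 * k)]
    field_simp
  have e2 : (|x| / 2) ^ n / n.factorial * (|x| ^ (2 * k) / ((2 * k).factorial : ℝ)) =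
      (|x| / 2) ^ n * |x| ^ (2 * k) * (1 / ((2 * k).factorial * n.factorial)) := by
    field_simp
  rw [e, e2]
  refine mul_le_mul_of_nonneg_left (one_div_le_one_div_of_le (by positivity) ?_) (by positivity)
  calc ((2 * k).factorial : ℝ) * n.factorial
      ≤ 2 ^ (2 * k) * (k.factorial * k.factorial) * n.factorial := by gcongr
    _ = 2 ^ (2 * k) * (k.factorial * (n.factorial * k.factorial)) := by ring
    _ ≤ _ := by gcongr

lemma hasSum_bessel_majorant (n : ℕ) (x : ℝ) :
    HasSum (fun k : ℕ => (|x| / 2) ^ n / n.factorial * (|x| ^ (2 * k) / ((2 * k).factorial : ℝ)))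
      ((|x| / 2) ^ n / n.factorial * Real.cosh |x|) :=
  (Real.hasSum_cosh |x|).mul_left _

lemma cosh_le_exp_of_nonneg {x : ℝ} (hx : 0 ≤ x) : Real.cosh x ≤ Real.exp x := by
  rw [Real.cosh_eq]
  have : Real.exp (-x) ≤ Real.exp x := Real.exp_le_exp.2 (by linarith)
  linarith

lemma summable_besselI (n : ℕ) (x : ℝ) : Summable fun k : ℕ =>
    1 / ((k.factorial : ℝ) * ((k + n).factorial : ℝ)) * (x / 2) ^ (2 * k + n) :=
  .of_norm_bounded (hasSum_bessel_majorant n x).summable (bessel_coeff_le n · x)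

lemma besselJ_coeff_le (n k : ℕ) (x : ℝ) :
    |(-1 : ℝ) ^ k / ((k.factorial : ℝ) * ((k + n).factorial : ℝ)) * (x / 2) ^ (2 * k + n)| ≤
      (|x| / 2) ^ n / n.factorial * (|x| ^ (2 * k) / ((2 * k).factorial : ℝ)) := by
  convert! bessel_coeff_le n k x using 1
  simp only [abs_mul, abs_div, abs_pow, abs_neg, abs_one, one_pow]

lemma summable_besselJ (n : ℕ) (x : ℝ) : Summable fun k : ℕ =>
    (-1 : ℝ) ^ k / ((k.factorial : ℝ) * ((k + n).factorial : ℝ)) * (x / 2) ^ (2 * k + n) :=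
  .of_norm_bounded (hasSum_bessel_majorant n x).summable (besselJ_coeff_le n · x)

lemma abs_besselI_le (n : ℕ) (x : ℝ) :
    |besselI n x| ≤ (|x| / 2) ^ n / n.factorial * Real.exp |x| := by
  rw [← Real.norm_eq_abs, besselI]
  exact (tsum_of_norm_bounded (hasSum_bessel_majorant n x) (bessel_coeff_le n · x)).trans
    (mul_le_mul_of_nonneg_left (cosh_le_exp_of_nonneg (abs_nonneg x)) (by positivity))

lemma abs_besselJ_le (n : ℕ) (x : ℝ) :
    |besselJ n x| ≤ (|x| / 2) ^ n / n.factorial * Real.exp |x| := by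
  rw [← Real.norm_eq_abs, besselJ]
  exact (tsum_of_norm_bounded (hasSum_bessel_majorant n x) (besselJ_coeff_le n · x)).trans
    (mul_le_mul_of_nonneg_left (cosh_le_exp_of_nonneg (abs_nonneg x)) (by positivity))

lemma besselI_nonneg (n : ℕ) {x : ℝ} (hx : 0 ≤ x) : 0 ≤ besselI n x :=
  tsum_nonneg fun _ => by positivity

lemma measurable_of_hasSum_nat {f : ℕ → ℝ → ℝ} {g : ℝ → ℝ} (hf : ∀ k, Measurable (f k))
    (h : ∀ x, HasSum (f · x) (g x)) : Measurable g :=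
  measurable_of_tendsto_metrizable
    (fun n => Finset.measurable_sum (Finset.range n) fun k _ => hf k)
    (tendsto_pi_nhds.2 fun x => by simpa using (h x).tendsto_sum_nat)

lemma measurable_besselI (n : ℕ) : Measurable (besselI n) :=
  measurable_of_hasSum_nat (fun k => by fun_prop) fun x => (summable_besselI n x).hasSum

lemma measurable_besselJ (n : ℕ) : Measurable (besselJ n) :=
  measurable_of_hasSum_nat (fun k => by fun_prop) fun x => (summable_besselJ n x).hasSum

/-! ### Generating function of the `I_n` -/

/-- Pairs of naturals, encoded by their difference and their minimum. -/
def diffMinEquiv : ℤ × ℕ ≃ ℕ × ℕ where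
  toFun q := (q.2 + q.1.toNat, q.2 + (-q.1).toNat)
  invFun p := ((p.1 : ℤ) - p.2, min p.1 p.2)
  left_inv q := by
    ext
    · simp
    · simp; omega
  right_inv p := by
    ext
    · simp; omega
    · simp; omega

lemma diffMinEquiv_apply (q : ℤ × ℕ) :
    diffMinEquiv q = (q.2 + q.1.toNat, q.2 + (-q.1).toNat) := rfl

/-- In the product of the exponential series of `(z/2)e^w` and `(z/2)e^{-w}`, the exponents differ
by `m` and have minimum `k`. Fixing `m` therefore collects exactly the power series of `I_{|m|}`. -/
lemma laurent_coeff_eq (z w : ℂ) (m : ℤ) (k : ℕ) :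
    (z / 2 * Complex.exp w) ^ (k + m.toNat) / ((k + m.toNat).factorial : ℂ) *
      ((z / 2 * Complex.exp (-w)) ^ (k + (-m).toNat) / ((k + (-m).toNat).factorial : ℂ)) =
    1 / ((k.factorial : ℂ) * ((k + m.natAbs).factorial : ℂ)) * (z / 2) ^ (2 * k + m.natAbs) *
      Complex.exp (m * w) := by
  simp only [mul_pow, ← Complex.exp_nat_mul]
  rcases Int.eq_nat_or_neg m with ⟨n, rfl | rfl⟩
  · simp only [Int.toNat_natCast, Int.natAbs_natCast, Int.toNat_neg_natCast, add_zero]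
    rw [show 2 * k + n = (k + n) + k by ring, pow_add (z / 2) (k + n)]
    have : Complex.exp (((n : ℤ) : ℂ) * w) =
        Complex.exp (((k + n : ℕ) : ℂ) * w) * Complex.exp ((k : ℂ) * -w) := by
      rw [← Complex.exp_add]; congr 1; push_cast; ring
    rw [this]; ring
  · simp only [Int.toNat_natCast, Int.natAbs_natCast, Int.natAbs_neg, neg_neg,
      Int.toNat_neg_natCast, add_zero]
    rw [show 2 * k + n = (k + n) + k by ring, pow_add (z / 2) (k + n)]
    have : Complex.exp (((-(n : ℤ) : ℤ) : ℂ) * w) =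
        Complex.exp (((k + n : ℕ) : ℂ) * -w) * Complex.exp ((k : ℂ) * w) := by
      rw [← Complex.exp_add]; congr 1; push_cast; ring
    rw [this]; ring

lemma hasSum_exp_mul_exp (z v : ℂ) :
    HasSum (fun n : ℕ => (z / 2 * Complex.exp v) ^ n / (n.factorial : ℂ))
      (Complex.exp (z / 2 * Complex.exp v)) := by
  generalize z / 2 * Complex.exp v = u
  rw [Complex.exp_eq_exp_ℂ]
  exact NormedSpace.expSeries_div_hasSum_exp u

lemma hasSum_mul_of_hasSum {f g : ℕ → ℂ} {s t : ℂ} (hf : HasSum f s) (hg : HasSum g t) :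
    HasSum (fun p : ℕ × ℕ => f p.1 * g p.2) (s * t) :=
  hf.mul hg (summable_mul_of_summable_norm hf.summable.norm hg.summable.norm)

lemma exp_mul_cosh (z w : ℂ) : Complex.exp (z * Complex.cosh w) =
    Complex.exp (z / 2 * Complex.exp w) * Complex.exp (z / 2 * Complex.exp (-w)) := by
  rw [← Complex.exp_add, Complex.cosh]
  congr 1
  ring

lemma hasSum_prod_exp_mul_exp (z w : ℂ) :
    HasSum (fun p : ℕ × ℕ => (z / 2 * Complex.exp w) ^ p.1 / (p.1.factorial : ℂ) *
        ((z / 2 * Complex.exp (-w)) ^ p.2 / (p.2.factorial : ℂ)))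
      (Complex.exp (z * Complex.cosh w)) := by
  rw [exp_mul_cosh]
  have h := hasSum_mul_of_hasSum (hasSum_exp_mul_exp z w) (hasSum_exp_mul_exp z (-w))
  exact h

lemma hasSum_prod_besselI_exp (z w : ℂ) :
    HasSum (fun q : ℤ × ℕ =>
      1 / ((q.2.factorial : ℂ) * ((q.2 + q.1.natAbs).factorial : ℂ)) *
        (z / 2) ^ (2 * q.2 + q.1.natAbs) * Complex.exp (q.1 * w))
      (Complex.exp (z * Complex.cosh w)) := by
  have h := diffMinEquiv.hasSum_iff.2 (hasSum_prod_exp_mul_exp z w)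
  simpa only [Function.comp_def, diffMinEquiv_apply, laurent_coeff_eq] using h

/-- The Laurent expansion of `exp (z cosh w)` in powers of `exp w`. -/
lemma hasSum_int_besselI_exp (z : ℝ) (w : ℂ) :
    HasSum (fun m : ℤ => (besselI m.natAbs z : ℂ) * Complex.exp (m * w))
      (Complex.exp (z * Complex.cosh w)) := by
  refine (hasSum_prod_besselI_exp z w).prod_fiberwise fun m => ?_
  have hI := (Complex.hasSum_ofReal.2 (summable_besselI m.natAbs z).hasSum).mul_right
    (Complex.exp (m * w))
  push_cast at hI
  rw [besselI]
  push_cast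
  exact hI

/-- The generating function of the modified Bessel functions `I_n`. -/
lemma hasSum_besselI_cosh (z : ℝ) (w : ℂ) :
    HasSum (fun n : ℕ => 2 * (besselI n z : ℂ) * Complex.cosh (n * w))
      (Complex.exp (z * Complex.cosh w) + besselI 0 z) := by
  -- Folding `m` with `-m` counts `m = 0` twice, hence the extra `besselI 0 z`. The same convention,
  -- a full `n = 0` term balanced by half of it on the other side, persists in the cosine series
  -- below.
  have := (hasSum_int_besselI_exp z w).nat_add_neg
  simp only [Int.natAbs_natCast, Int.natAbs_neg, Int.natAbs_zero, Int.cast_zero, zero_mul,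
    Complex.exp_zero, mul_one] at this
  refine this.congr_fun fun n => ?_
  rw [Complex.cosh]
  push_cast
  ring_nf

/-- The real part of the generating function of the `I_n` at `w = t + iθ`. -/
lemma hasSum_besselI_cosh_mul_cos (z t θ : ℝ) :
    HasSum (fun n : ℕ => 2 * besselI n z * (Real.cosh (n * t) * Real.cos (n * θ)))
      (Real.exp (z * (Real.cosh t * Real.cos θ)) * Real.cos (z * (Real.sinh t * Real.sin θ)) +
        besselI 0 z) := by
  have key (s φ : ℝ) : Complex.cosh (s + φ * Complex.I) =
      (Real.cosh s * Real.cos φ : ℝ) + (Real.sinh s * Real.sin φ : ℝ) * Complex.I := by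
    rw [Complex.cosh_add, Complex.cosh_mul_I, Complex.sinh_mul_I]
    push_cast; ring
  have := Complex.hasSum_re (hasSum_besselI_cosh z (t + θ * Complex.I))
  convert! this using 1
  · ext n
    rw [show (n : ℂ) * (t + θ * Complex.I) = (n * t : ℝ) + (n * θ : ℝ) * Complex.I by
      push_cast; ring, key]
    rw [show (2 : ℂ) * (besselI n z : ℂ) = (2 * besselI n z : ℝ) by push_cast; ring,
      Complex.re_ofReal_mul, Complex.add_re, Complex.ofReal_re, Complex.re_ofReal_mul]
    simp
  · rw [key, Complex.add_re, Complex.exp_re, Complex.re_ofReal_mul, Complex.im_ofReal_mul,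
      Complex.add_re, Complex.add_im, Complex.ofReal_re, Complex.ofReal_im, Complex.re_ofReal_mul,
      Complex.im_ofReal_mul]
    simp only [Complex.I_re, Complex.I_im, Complex.ofReal_re]
    ring_nf

/-! ### The Bessel functions `K` -/

lemma image_exp_univ : Real.exp '' univ = Ioi 0 := by
  rw [image_univ, Real.range_exp]

lemma integral_pow_mul_exp_neg (n : ℕ) {x : ℝ} (hx : 0 < x) :
    ∫ u in Ioi (0 : ℝ), u ^ n * Real.exp (-(x / 2 * u)) = (2 / x) ^ (n + 1) * n.factorial := by
  have := Real.integral_rpow_mul_exp_neg_mul_Ioi (a := n + 1) (r := x / 2) (by positivity)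
    (by positivity)
  rw [Real.Gamma_nat_eq_factorial, one_div_div] at this
  simp only [add_sub_cancel_right, Real.rpow_natCast] at this
  rw [this]
  norm_cast

/-- The integrand `exp (-x e^t / 2) e^{(n+1) t}` dominating that of `2 K_{n+1} x`. -/
lemma integrable_exp_exp (n : ℕ) {x : ℝ} (hx : 0 < x) :
    Integrable (fun t : ℝ => Real.exp (-(x / 2 * Real.exp t)) * Real.exp ((n + 1 : ℕ) * t)) ∧
    ∫ t : ℝ, Real.exp (-(x / 2 * Real.exp t)) * Real.exp ((n + 1 : ℕ) * t) =
      (2 / x) ^ (n + 1) * n.factorial := by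
  have hd : ∀ t ∈ (univ : Set ℝ), HasDerivWithinAt Real.exp (Real.exp t) univ t :=
    fun t _ => (Real.hasDerivAt_exp t).hasDerivWithinAt
  have hE (t : ℝ) : |Real.exp t| • (Real.exp t ^ n * Real.exp (-(x / 2 * Real.exp t))) =
      Real.exp (-(x / 2 * Real.exp t)) * Real.exp ((n + 1 : ℕ) * t) := by
    rw [abs_of_pos (Real.exp_pos t), Real.exp_nat_mul, smul_eq_mul]; ring
  -- The substitution `u = e^t` turns the integral into a Gamma integral over `(0, ∞)`.
  have h1 := integral_image_eq_integral_abs_deriv_smul MeasurableSet.univ hd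
    Real.exp_injective.injOn (fun u => u ^ n * Real.exp (-(x / 2 * u)))
  have h2 := integrableOn_image_iff_integrableOn_abs_deriv_smul MeasurableSet.univ hd
    Real.exp_injective.injOn (fun u => u ^ n * Real.exp (-(x / 2 * u)))
  simp only [hE, image_exp_univ, Measure.restrict_univ, integrableOn_univ] at h1 h2
  have hv := integral_pow_mul_exp_neg n hx
  -- A non-integrable function has integral `0` by default, so the positive value already proves
  -- integrability.
  refine ⟨h2.1 (.of_integral_ne_zero ?_), by rw [← h1, hv]⟩
  rw [hv]; positivity

lemma half_exp_le_cosh (t : ℝ) : Real.exp t / 2 ≤ Real.cosh t := by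
  rw [Real.cosh_eq]; linarith [Real.exp_pos (-t)]

lemma besselK_integrand_nonneg (n : ℕ) (x t : ℝ) :
    0 ≤ Real.exp (-x * Real.cosh t) * Real.cosh (n * t) :=
  mul_nonneg (Real.exp_pos _).le (Real.cosh_pos _).le

/-- Uses `cosh s ≥ e^s / 2` at `s = ±t`. The majorant is symmetrized so that its integral over the
half line is half of a full-line Gamma integral. -/
lemma besselK_integrand_le (n : ℕ) {x : ℝ} (hx : 0 < x) (t : ℝ) :
    Real.exp (-x * Real.cosh t) * Real.cosh (n * t) ≤
      (Real.exp (-(x / 2 * Real.exp t)) * Real.exp (n * t) +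
        Real.exp (-(x / 2 * Real.exp (-t))) * Real.exp (n * -t)) / 2 := by
  have h (s : ℝ) : Real.exp (-x * Real.cosh s) ≤ Real.exp (-(x / 2 * Real.exp s)) :=
    Real.exp_le_exp.2 (by nlinarith [half_exp_le_cosh s])
  have h1 := mul_le_mul_of_nonneg_right (h t) (Real.exp_pos (n * t)).le
  have h2 := mul_le_mul_of_nonneg_right (h (-t)) (Real.exp_pos (n * -t)).le
  rw [Real.cosh_neg] at h2
  rw [Real.cosh_eq (n * t), ← mul_neg]
  linarith

lemma integrableOn_besselK_succ (n : ℕ) {x : ℝ} (hx : 0 < x) :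
    IntegrableOn (fun t => Real.exp (-x * Real.cosh t) * Real.cosh ((n + 1 : ℕ) * t)) (Ioi 0) := by
  have h := (integrable_exp_exp n hx).1
  refine (((h.add h.comp_neg).div_const 2).mono' (by fun_prop)
    (ae_of_all _ fun t => ?_)).integrableOn
  rw [Real.norm_of_nonneg (besselK_integrand_nonneg _ x t)]
  exact besselK_integrand_le _ hx t

/-- Order `0` needs a separate argument: the full-line majorant for `n = 0` tends to `1` at `-∞` and
is not integrable. It is controlled by order `1` instead. -/
lemma besselK_zero_integrand_le (x t : ℝ) :
    Real.exp (-x * Real.cosh t) * Real.cosh ((0 : ℕ) * t) ≤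
      Real.exp (-x * Real.cosh t) * Real.cosh ((1 : ℕ) * t) := by
  simpa using le_mul_of_one_le_right (Real.exp_pos _).le (Real.one_le_cosh t)

lemma integrableOn_besselK (n : ℕ) {x : ℝ} (hx : 0 < x) :
    IntegrableOn (fun t => Real.exp (-x * Real.cosh t) * Real.cosh (n * t)) (Ioi 0) := by
  cases n with
  | succ n => exact integrableOn_besselK_succ n hx
  | zero =>
    refine (integrableOn_besselK_succ 0 hx).mono' (by fun_prop) (ae_of_all _ fun t => ?_)
    rw [Real.norm_of_nonneg (besselK_integrand_nonneg _ x t)]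
    exact besselK_zero_integrand_le x t

lemma besselK_nonneg (n : ℕ) (x : ℝ) : 0 ≤ besselK n x :=
  integral_nonneg fun t => besselK_integrand_nonneg n x t

lemma besselK_succ_le (n : ℕ) {x : ℝ} (hx : 0 < x) :
    besselK (n + 1) x ≤ (2 / x) ^ (n + 1) * n.factorial / 2 := by
  obtain ⟨h, hv⟩ := integrable_exp_exp n hx
  set F : ℝ → ℝ := fun t => Real.exp (-(x / 2 * Real.exp t)) * Real.exp ((n + 1 : ℕ) * t)
  calc besselK (n + 1) x ≤ ∫ t in Ioi 0, (F t + F (-t)) / 2 :=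
        setIntegral_mono (integrableOn_besselK_succ n hx)
          ((h.add h.comp_neg).div_const 2).integrableOn (besselK_integrand_le _ hx)
    _ = (∫ t, F t) / 2 := by
        rw [integral_div, integral_add h.integrableOn h.comp_neg.integrableOn,
          integral_comp_neg_Ioi, neg_zero, add_comm, ← intervalIntegral.integral_Iic_add_Ioi
          h.integrableOn h.integrableOn]
    _ = _ := by rw [hv]

lemma besselK_zero_le_one {x : ℝ} (hx : 0 < x) : besselK 0 x ≤ besselK 1 x :=
  setIntegral_mono (integrableOn_besselK 0 hx) (integrableOn_besselK 1 hx)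
    (besselK_zero_integrand_le x)

lemma besselK_zero_le {x : ℝ} (hx : 0 < x) : besselK 0 x ≤ 1 / x := by
  refine (besselK_zero_le_one hx).trans ((besselK_succ_le 0 hx).trans_eq ?_)
  simp; ring

lemma besselK_zero_anti {x y : ℝ} (hx : 0 < x) (hxy : x ≤ y) : besselK 0 y ≤ besselK 0 x := by
  refine setIntegral_mono (integrableOn_besselK 0 (hx.trans_le hxy)) (integrableOn_besselK 0 hx)
    fun t => mul_le_mul_of_nonneg_right (Real.exp_le_exp.2 ?_) (Real.cosh_pos _).le
  nlinarith [Real.cosh_pos t]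

lemma measurable_besselK (n : ℕ) : Measurable (besselK n) := by
  have : StronglyMeasurable (Function.uncurry fun x t : ℝ =>
      Real.exp (-x * Real.cosh t) * Real.cosh (n * t)) :=
    (Continuous.stronglyMeasurable (by simp only [Function.uncurry_def]; fun_prop))
  exact (this.integral_prod_right (ν := volume.restrict (Ioi 0))).measurable

/-! ### Graf's addition theorem for `K_0` -/

/-- The real part of `exp (-R cosh (t - iφ))`. -/
noncomputable def rotatedIntegrand (R φ t : ℝ) : ℝ :=
  Real.exp (-(R * Real.cos φ) * Real.cosh t) * Real.cos (R * Real.sin φ * Real.sinh t)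

/-- The derivative of `rotatedIntegrand R φ t` in `φ`. -/
noncomputable def rotatedDeriv (R φ t : ℝ) : ℝ :=
  Real.exp (-(R * Real.cos φ) * Real.cosh t) *
    (R * Real.sin φ * Real.cosh t * Real.cos (R * Real.sin φ * Real.sinh t) -
      R * Real.cos φ * Real.sinh t * Real.sin (R * Real.sin φ * Real.sinh t))

lemma hasDerivAt_rotatedIntegrand (R φ t : ℝ) :
    HasDerivAt (fun φ => rotatedIntegrand R φ t) (rotatedDeriv R φ t) φ := by
  have h1 : HasDerivAt (fun φ => -(R * Real.cos φ) * Real.cosh t)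
      (-(R * -Real.sin φ) * Real.cosh t) φ :=
    (((Real.hasDerivAt_cos φ).const_mul R).neg).mul_const _
  have h2 : HasDerivAt (fun φ => R * Real.sin φ * Real.sinh t)
      (R * Real.cos φ * Real.sinh t) φ :=
    ((Real.hasDerivAt_sin φ).const_mul R).mul_const _
  refine (h1.exp.mul h2.cos).congr_deriv ?_
  rw [rotatedDeriv]; ring

/-- A Cauchy–Riemann equation for `exp(-R cosh(t - iφ))`: the `φ`-derivative of the real part is the
`t`-derivative of the imaginary part. Its integral over `t` thus reduces to boundary values, which
vanish at `0` and at infinity. -/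
lemma hasDerivAt_exp_mul_sin (R φ t : ℝ) :
    HasDerivAt (fun t => Real.exp (-(R * Real.cos φ) * Real.cosh t) *
      Real.sin (R * Real.sin φ * Real.sinh t)) (rotatedDeriv R φ t) t := by
  have h1 : HasDerivAt (fun t => -(R * Real.cos φ) * Real.cosh t)
      (-(R * Real.cos φ) * Real.sinh t) t := (Real.hasDerivAt_cosh t).const_mul _
  have h2 : HasDerivAt (fun t => R * Real.sin φ * Real.sinh t)
      (R * Real.sin φ * Real.cosh t) t := (Real.hasDerivAt_sinh t).const_mul _
  refine (h1.exp.mul h2.sin).congr_deriv ?_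
  rw [rotatedDeriv]; ring

lemma abs_sinh_le_cosh (t : ℝ) : |Real.sinh t| ≤ Real.cosh t :=
  abs_le.2 ⟨by rw [Real.sinh_eq, Real.cosh_eq]; linarith [Real.exp_pos t, Real.exp_pos (-t)],
    (Real.sinh_lt_cosh t).le⟩

lemma abs_rotatedDeriv_le {R φ c : ℝ} (hR : 0 < R) (hc : c ≤ Real.cos φ) (t : ℝ) :
    |rotatedDeriv R φ t| ≤
      2 * R * (Real.exp (-(R * c) * Real.cosh t) * Real.cosh ((1 : ℕ) * t)) := by
  have hch := Real.cosh_pos t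
  have h1 : |R * Real.sin φ * Real.cosh t * Real.cos (R * Real.sin φ * Real.sinh t)| ≤
      R * Real.cosh t := by
    rw [abs_mul, abs_mul, abs_mul, abs_of_pos hR, abs_of_pos hch]
    calc R * |Real.sin φ| * Real.cosh t * |Real.cos (R * Real.sin φ * Real.sinh t)|
        ≤ R * 1 * Real.cosh t * 1 := by
          gcongr
          · exact Real.abs_sin_le_one _
          · exact Real.abs_cos_le_one _
      _ = _ := by ring
  have h2 : |R * Real.cos φ * Real.sinh t * Real.sin (R * Real.sin φ * Real.sinh t)| ≤
      R * Real.cosh t := by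
    rw [abs_mul, abs_mul, abs_mul, abs_of_pos hR]
    calc R * |Real.cos φ| * |Real.sinh t| * |Real.sin (R * Real.sin φ * Real.sinh t)|
        ≤ R * 1 * Real.cosh t * 1 := by
          gcongr
          · exact Real.abs_cos_le_one _
          · exact abs_sinh_le_cosh t
          · exact Real.abs_sin_le_one _
      _ = _ := by ring
  have h3 : Real.exp (-(R * Real.cos φ) * Real.cosh t) ≤ Real.exp (-(R * c) * Real.cosh t) :=
    Real.exp_le_exp.2 (mul_le_mul_of_nonneg_right
      (neg_le_neg (mul_le_mul_of_nonneg_left hc hR.le)) hch.le)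
  rw [rotatedDeriv, abs_mul, Real.abs_exp, Nat.cast_one, one_mul]
  calc _ ≤ Real.exp (-(R * c) * Real.cosh t) * (R * Real.cosh t + R * Real.cosh t) := by
        gcongr
        exact (abs_sub _ _).trans (add_le_add h1 h2)
    _ = _ := by ring

lemma integrable_rotatedDeriv {R φ : ℝ} (hR : 0 < R) (hφ : 0 < Real.cos φ) :
    IntegrableOn (rotatedDeriv R φ) (Ioi 0) :=
  (((integrableOn_besselK 1 (mul_pos hR hφ)).const_mul (2 * R))).mono'
    (Continuous.aestronglyMeasurable (by unfold rotatedDeriv; fun_prop))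
    (ae_of_all _ fun t => abs_rotatedDeriv_le hR le_rfl t)

lemma tendsto_cosh_atTop : Tendsto Real.cosh atTop atTop :=
  tendsto_atTop_mono half_exp_le_cosh (Real.tendsto_exp_atTop.atTop_div_const two_pos)

lemma integral_rotatedDeriv {R φ : ℝ} (hR : 0 < R) (hφ : 0 < Real.cos φ) :
    ∫ t in Ioi (0 : ℝ), rotatedDeriv R φ t = 0 := by
  have ht : Tendsto (fun t => Real.exp (-(R * Real.cos φ) * Real.cosh t) *
      Real.sin (R * Real.sin φ * Real.sinh t)) atTop (𝓝 0) := by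
    have : Tendsto (fun t => Real.exp (-(R * Real.cos φ) * Real.cosh t)) atTop (𝓝 0) :=
      Real.tendsto_exp_atBot.comp
        (tendsto_cosh_atTop.const_mul_atTop_of_neg (neg_lt_zero.2 (mul_pos hR hφ)))
    refine squeeze_zero_norm (fun t => ?_) this
    rw [norm_mul, Real.norm_of_nonneg (Real.exp_pos _).le]
    exact mul_le_of_le_one_right (Real.exp_pos _).le (Real.abs_sin_le_one _)
  rw [integral_Ioi_of_hasDerivAt_of_tendsto' (fun t _ => hasDerivAt_exp_mul_sin R φ t)
    (integrable_rotatedDeriv hR hφ) ht]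
  simp

lemma integrable_rotatedIntegrand {R φ : ℝ} (hR : 0 < R) (hφ : 0 < Real.cos φ) :
    IntegrableOn (rotatedIntegrand R φ) (Ioi 0) := by
  refine (integrableOn_besselK 0 (mul_pos hR hφ)).mono'
    (Continuous.aestronglyMeasurable (by unfold rotatedIntegrand; fun_prop))
    (ae_of_all _ fun t => ?_)
  rw [rotatedIntegrand, norm_mul, Real.norm_of_nonneg (Real.exp_pos _).le]
  simpa using mul_le_of_le_one_right (Real.exp_pos _).le (Real.abs_cos_le_one _)

lemma hasDerivAt_integral_rotatedIntegrand {R φ : ℝ} (hR : 0 < R) (hφ : 0 < Real.cos φ) :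
    HasDerivAt (fun φ => ∫ t in Ioi (0 : ℝ), rotatedIntegrand R φ t) 0 φ := by
  -- On this neighbourhood the `K_1` integrand at `R cos φ / 2` dominates all the derivatives.
  have hs : {ψ : ℝ | Real.cos φ / 2 < Real.cos ψ} ∈ 𝓝 φ :=
    (isOpen_lt continuous_const Real.continuous_cos).mem_nhds
      (by simp only [mem_ofPred_eq]; linarith)
  have := hasDerivAt_integral_of_dominated_loc_of_deriv_le (μ := volume.restrict (Ioi 0))
    (F := rotatedIntegrand R) (F' := rotatedDeriv R) hs
    (Eventually.of_forall fun ψ =>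
      (Continuous.aestronglyMeasurable (by unfold rotatedIntegrand; fun_prop)))
    (integrable_rotatedIntegrand hR hφ) (integrable_rotatedDeriv hR hφ).aestronglyMeasurable
    (ae_of_all _ fun t ψ (hψ : _ < _) => abs_rotatedDeriv_le hR hψ.le t)
    ((integrableOn_besselK 1 (mul_pos hR (half_pos hφ))).const_mul (2 * R))
    (ae_of_all _ fun t ψ _ => hasDerivAt_rotatedIntegrand R ψ t)
  simpa only [integral_rotatedDeriv hR hφ] using this.2

lemma integral_rotatedIntegrand {R φ : ℝ} (hR : 0 < R) (hφ : |φ| < Real.pi / 2) :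
    ∫ t in Ioi (0 : ℝ), rotatedIntegrand R φ t = besselK 0 R := by
  have hcos : ∀ ψ ∈ Ioo (-(Real.pi / 2)) (Real.pi / 2), 0 < Real.cos ψ :=
    fun ψ hψ => Real.cos_pos_of_mem_Ioo hψ
  have hd : ∀ ψ ∈ Ioo (-(Real.pi / 2)) (Real.pi / 2),
      HasDerivAt (fun φ => ∫ t in Ioi (0 : ℝ), rotatedIntegrand R φ t) 0 ψ :=
    fun ψ hψ => hasDerivAt_integral_rotatedIntegrand hR (hcos ψ hψ)
  have := isOpen_Ioo.is_const_of_deriv_eq_zero isPreconnected_Ioo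
    (fun ψ hψ => (hd ψ hψ).differentiableAt.differentiableWithinAt)
    (fun ψ hψ => (hd ψ hψ).deriv) (abs_lt.1 hφ)
    (show (0 : ℝ) ∈ Ioo (-(Real.pi / 2)) (Real.pi / 2) by constructor <;> linarith [Real.pi_pos])
  rw [this]
  simp [rotatedIntegrand, besselK]

/-- With `X = R cos φ` and `Y = R sin φ`, positivity of `X` means `|φ| < π/2`, the range in which
the rotated integral does not depend on `φ`. -/
lemma besselK_zero_sqrt {X : ℝ} (Y : ℝ) (hX : 0 < X) :
    besselK 0 (√(X ^ 2 + Y ^ 2)) =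
      ∫ t in Ioi (0 : ℝ), Real.exp (-X * Real.cosh t) * Real.cos (Y * Real.sinh t) := by
  have hR : 0 < √(X ^ 2 + Y ^ 2) := Real.sqrt_pos.2 (by positivity)
  have hn : ‖(⟨X, Y⟩ : ℂ)‖ = √(X ^ 2 + Y ^ 2) := Complex.norm_eq_sqrt_sq_add_sq _
  rw [← integral_rotatedIntegrand hR (φ := Complex.arg ⟨X, Y⟩)
    (Complex.abs_arg_lt_pi_div_two_iff.2 (.inl hX))]
  simp only [rotatedIntegrand, ← hn, Complex.norm_mul_cos_arg, Complex.norm_mul_sin_arg]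

lemma integrable_besselK_mul {d : ℝ} (c : ℝ) (n : ℕ) (hd : 0 < d) :
    IntegrableOn (fun t => Real.exp (-d * Real.cosh t) * (c * Real.cosh (n * t))) (Ioi 0) :=
  IntegrableOn.congr_fun ((integrableOn_besselK n hd).const_mul c) (fun t _ => by ring)
    measurableSet_Ioi

/-- This is Graf's series at `θ = 0`, where every term is nonnegative: partial sums are bounded by
the integral of the full generating function, finite because `r < d`. It dominates the series for
every other `θ`. -/
lemma summable_besselI_mul_besselK {r d : ℝ} (hr : 0 ≤ r) (hrd : r < d) :
    Summable fun n : ℕ => 2 * besselI n r * besselK n d := by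
  have hd := hr.trans_lt hrd
  have key (t : ℝ) : HasSum (fun n : ℕ =>
      Real.exp (-d * Real.cosh t) * (2 * besselI n r * Real.cosh (n * t)))
      (Real.exp (-d * Real.cosh t) * (Real.exp (r * Real.cosh t) + besselI 0 r)) := by
    simpa using (hasSum_besselI_cosh_mul_cos r t 0).mul_left (Real.exp (-d * Real.cosh t))
  have hi : IntegrableOn (fun t => Real.exp (-d * Real.cosh t) *
      (Real.exp (r * Real.cosh t) + besselI 0 r)) (Ioi 0) := by
    have h1 := integrableOn_besselK 0 (sub_pos.2 hrd)
    have h2 := integrable_besselK_mul (besselI 0 r) 0 hd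
    refine IntegrableOn.congr_fun (h1.add h2) (fun t _ => ?_) measurableSet_Ioi
    simp only [Pi.add_apply, CharP.cast_eq_zero, zero_mul, Real.cosh_zero, mul_one]
    rw [mul_add, ← Real.exp_add]
    ring_nf
  have hpos (n : ℕ) (t : ℝ) :
      0 ≤ Real.exp (-d * Real.cosh t) * (2 * besselI n r * Real.cosh (n * t)) :=
    mul_nonneg (Real.exp_pos _).le (mul_nonneg (mul_nonneg two_pos.le (besselI_nonneg n hr))
      (Real.cosh_pos _).le)
  have hv (n : ℕ) : 2 * besselI n r * besselK n d = ∫ t in Ioi 0,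
      Real.exp (-d * Real.cosh t) * (2 * besselI n r * Real.cosh (n * t)) := by
    rw [besselK, ← integral_const_mul]; congr 1; ext t; ring
  refine summable_of_sum_le (c := ∫ t in Ioi 0, Real.exp (-d * Real.cosh t) *
      (Real.exp (r * Real.cosh t) + besselI 0 r)) (fun n => ?_) fun u => ?_
  · exact mul_nonneg (mul_nonneg two_pos.le (besselI_nonneg n hr)) (besselK_nonneg n d)
  · simp only [hv]
    rw [← integral_finsetSum _ fun n _ => integrable_besselK_mul _ n hd]
    refine integral_mono (integrable_finsetSum _ fun n _ => integrable_besselK_mul _ n hd) hi ?_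
    exact fun t => sum_le_hasSum u (fun n _ => hpos n t) (key t)

/-- Graf's addition theorem for `K_0`. -/
theorem hasSum_besselI_mul_besselK_mul_cos {r d : ℝ} (hr : 0 ≤ r) (hrd : r < d) (θ : ℝ) :
    HasSum (fun n : ℕ => 2 * besselI n r * besselK n d * Real.cos (n * θ))
      (besselK 0 (√((r * Real.cos θ - d) ^ 2 + (r * Real.sin θ) ^ 2)) +
        besselI 0 r * besselK 0 d) := by
  have hd := hr.trans_lt hrd
  have hX : 0 < d - r * Real.cos θ := by nlinarith [Real.cos_le_one θ]
  -- The factors `exp(-d cosh t)` and `exp(r cos θ cosh t)` merge into the integrand of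
  -- `besselK_zero_sqrt` with `X = d - r cos θ`; the second summand is the doubled `n = 0` term.
  have key (t : ℝ) : HasSum (fun n : ℕ => Real.exp (-d * Real.cosh t) *
        (2 * besselI n r * Real.cos (n * θ) * Real.cosh (n * t)))
      (Real.exp (-(d - r * Real.cos θ) * Real.cosh t) *
        Real.cos (r * Real.sin θ * Real.sinh t) +
        Real.exp (-d * Real.cosh t) * (besselI 0 r * Real.cosh ((0 : ℕ) * t))) := by
    convert! (hasSum_besselI_cosh_mul_cos r t θ).mul_left (Real.exp (-d * Real.cosh t)) using 1
    · ext n; ring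
    · rw [show -(d - r * Real.cos θ) * Real.cosh t =
        -d * Real.cosh t + r * (Real.cosh t * Real.cos θ) by ring, Real.exp_add]
      simp only [CharP.cast_eq_zero, zero_mul, Real.cosh_zero, mul_one]
      ring_nf
  have hn (n : ℕ) : ∫ t in Ioi (0 : ℝ), ‖Real.exp (-d * Real.cosh t) *
      (2 * besselI n r * Real.cos (n * θ) * Real.cosh (n * t))‖ ≤
      2 * besselI n r * besselK n d := by
    rw [besselK, ← integral_const_mul]
    refine integral_mono (integrable_besselK_mul _ n hd).norm
      ((integrableOn_besselK n hd).const_mul _) fun t => ?_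
    have h0 : 0 ≤ 2 * besselI n r := mul_nonneg two_pos.le (besselI_nonneg n hr)
    simp only [norm_mul (Real.exp _), norm_mul (2 * besselI n r * _), norm_mul (2 * besselI n r)]
    rw [Real.norm_of_nonneg (Real.exp_pos _).le, Real.norm_of_nonneg h0,
      Real.norm_of_nonneg (Real.cosh_pos _).le]
    have := Real.abs_cos_le_one (n * θ)
    calc _ ≤ Real.exp (-d * Real.cosh t) * (2 * besselI n r * 1 * Real.cosh (n * t)) := by
          gcongr
          exact this
      _ = _ := by ring
  have := hasSum_integral_of_summable_integral_norm (μ := volume.restrict (Ioi (0 : ℝ)))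
    (fun n : ℕ => integrable_besselK_mul (2 * besselI n r * Real.cos (n * θ)) n hd)
    (.of_nonneg_of_le (fun n => integral_nonneg fun t => norm_nonneg _) hn
      (summable_besselI_mul_besselK hr hrd))
  simp only [(key _).tsum_eq] at this
  convert! this using 1
  · ext n
    rw [besselK, ← integral_const_mul, ← integral_mul_const]
    exact integral_congr_ae (ae_of_all _ fun t => by ring)
  · rw [integral_add _ (integrable_besselK_mul _ 0 hd)]
    · rw [show (r * Real.cos θ - d) ^ 2 = (d - r * Real.cos θ) ^ 2 by ring,
        besselK_zero_sqrt _ hX]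
      congr 1
      rw [besselK, ← integral_const_mul]
      exact integral_congr_ae (ae_of_all _ fun t => by ring)
    · refine (integrableOn_besselK 0 hX).mono' (by fun_prop) (ae_of_all _ fun t => ?_)
      rw [norm_mul, Real.norm_of_nonneg (Real.exp_pos _).le]
      simpa using mul_le_of_le_one_right (Real.exp_pos _).le (Real.abs_cos_le_one _)

/-! ### Cosine series on the circle -/

lemma integral_cos_int_mul (k : ℤ) :
    ∫ θ in (-Real.pi)..Real.pi, Real.cos (k * θ) = if k = 0 then 2 * Real.pi else 0 := by
  split_ifs with h
  · simp [h]; ring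
  · have hk : (k : ℝ) ≠ 0 := by exact_mod_cast h
    rw [intervalIntegral.integral_comp_mul_left (fun u => Real.cos u) hk, integral_cos, mul_neg,
      Real.sin_neg, Real.sin_int_mul_pi]
    simp

lemma integral_cos_mul_cos (m n : ℕ) :
    ∫ θ in (-Real.pi)..Real.pi, Real.cos (m * θ) * Real.cos (n * θ) =
      if m = n then (if n = 0 then 2 * Real.pi else Real.pi) else 0 := by
  have h (θ : ℝ) : Real.cos (m * θ) * Real.cos (n * θ) =
      (Real.cos (((m - n : ℤ) : ℝ) * θ) + Real.cos (((m + n : ℤ) : ℝ) * θ)) / 2 := by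
    push_cast
    rw [sub_mul, add_mul, Real.cos_sub, Real.cos_add]; ring
  simp only [h]
  rw [intervalIntegral.integral_div, intervalIntegral.integral_add
    (Continuous.intervalIntegrable (by fun_prop) _ _)
    (Continuous.intervalIntegrable (by fun_prop) _ _), integral_cos_int_mul, integral_cos_int_mul]
  split_ifs <;> first | omega | ring

lemma hasSum_integral_cos_mul {α : ℕ → ℝ} {f h : ℝ → ℝ} (hα : Summable fun n => |α n|)
    (hf : ∀ θ, HasSum (fun n : ℕ => α n * Real.cos (n * θ)) (f θ)) (hh : Continuous h) :
    HasSum (fun n : ℕ => α n * ∫ θ in (-Real.pi)..Real.pi, Real.cos (n * θ) * h θ)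
      (∫ θ in (-Real.pi)..Real.pi, f θ * h θ) := by
  have hπ : -Real.pi ≤ Real.pi := by linarith [Real.pi_pos]
  have hi (n : ℕ) : Integrable (fun θ => α n * (Real.cos (n * θ) * h θ))
      (volume.restrict (Ioc (-Real.pi) Real.pi)) :=
    (Continuous.integrableOn_Icc (by fun_prop)).mono_set Ioc_subset_Icc_self
  have hn : IntegrableOn (fun θ => ‖h θ‖) (Ioc (-Real.pi) Real.pi) :=
    (Continuous.integrableOn_Icc (by fun_prop)).mono_set Ioc_subset_Icc_self
  have := hasSum_integral_of_summable_integral_norm hi <| by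
    refine .of_nonneg_of_le (fun n => integral_nonneg fun t => norm_nonneg _) (fun n => ?_)
      (hα.mul_right (∫ θ in Ioc (-Real.pi) Real.pi, ‖h θ‖))
    rw [← integral_const_mul]
    refine integral_mono (hi n).norm (hn.const_mul _) fun θ => ?_
    simp only [norm_mul, Real.norm_eq_abs]
    exact mul_le_mul_of_nonneg_left
      (mul_le_of_le_one_left (abs_nonneg _) (Real.abs_cos_le_one _)) (abs_nonneg _)
  simp only [intervalIntegral.integral_of_le hπ]
  convert! this using 1
  · ext n; rw [integral_const_mul]
  · refine integral_congr_ae (ae_of_all _ fun θ => ?_)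
    simpa [mul_assoc] using ((hf θ).mul_right (h θ)).tsum_eq.symm

lemma continuous_of_hasSum_cos {α : ℕ → ℝ} {f : ℝ → ℝ} (hα : Summable fun n => |α n|)
    (hf : ∀ θ, HasSum (fun n : ℕ => α n * Real.cos (n * θ)) (f θ)) : Continuous f := by
  have : f = fun θ => ∑' n : ℕ, α n * Real.cos (n * θ) := funext fun θ => (hf θ).tsum_eq.symm
  rw [this]
  refine continuous_tsum (fun n => by fun_prop) hα fun n θ => ?_
  rw [norm_mul]
  exact mul_le_of_le_one_right (abs_nonneg _) (Real.abs_cos_le_one _)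

lemma continuous_of_hasSum_cos_sub {α : ℕ → ℝ} {f : ℝ → ℝ} {c : ℝ} (hα : Summable fun n => |α n|)
    (hf : ∀ θ, HasSum (fun n : ℕ => α n * Real.cos (n * θ)) (f θ + c)) : Continuous f := by
  simpa [Pi.sub_def] using (continuous_of_hasSum_cos hα hf).sub (continuous_const (y := c))

/-- The cosine coefficients of `α 0 / 2 + ∑_{n ≥ 1} α n cos (n θ)`. -/
lemma integral_mul_cos_of_hasSum {α : ℕ → ℝ} {f : ℝ → ℝ} (hα : Summable fun n => |α n|)
    (hf : ∀ θ, HasSum (fun n : ℕ => α n * Real.cos (n * θ)) (f θ + α 0 / 2)) (m : ℕ) :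
    ∫ θ in (-Real.pi)..Real.pi, f θ * Real.cos (m * θ) = Real.pi * α m := by
  have h := hasSum_integral_cos_mul (h := fun θ => Real.cos (m * θ)) hα hf (by fun_prop)
  have hs := hasSum_single (f := fun n : ℕ => α n * ∫ θ in (-Real.pi)..Real.pi,
    Real.cos (n * θ) * Real.cos (m * θ)) m (fun n hn => by simp [integral_cos_mul_cos, hn])
  have hc : Continuous f := continuous_of_hasSum_cos_sub hα hf
  have e := h.unique hs
  simp only [add_mul] at e
  rw [intervalIntegral.integral_add (Continuous.intervalIntegrable (by fun_prop) _ _)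
    (Continuous.intervalIntegrable (by fun_prop) _ _), intervalIntegral.integral_const_mul,
    integral_cos_mul_cos, if_pos rfl] at e
  have e0 := integral_cos_int_mul m
  rw [Int.cast_natCast] at e0
  rw [e0] at e
  by_cases hm : m = 0
  · subst hm
    simp at e ⊢; linarith
  · simp [hm] at e ⊢; linarith

/-- Parseval's identity for cosine series. -/
lemma hasSum_integral_mul_of_hasSum_cos {α β : ℕ → ℝ} {f g : ℝ → ℝ}
    (hα : Summable fun n => |α n|) (hβ : Summable fun n => |β n|)
    (hf : ∀ θ, HasSum (fun n : ℕ => α n * Real.cos (n * θ)) (f θ + α 0 / 2))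
    (hg : ∀ θ, HasSum (fun n : ℕ => β n * Real.cos (n * θ)) (g θ + β 0 / 2)) :
    HasSum (fun n => Real.pi * (α n * β n))
      ((∫ θ in (-Real.pi)..Real.pi, f θ * g θ) + Real.pi * (α 0 * β 0) / 2) := by
  have hfc : Continuous f := continuous_of_hasSum_cos_sub hα hf
  have hgc : Continuous g := continuous_of_hasSum_cos_sub hβ hg
  have h := hasSum_integral_cos_mul hα hf hgc
  simp only [mul_comm _ (g _), integral_mul_cos_of_hasSum hβ hg] at h
  convert! h using 1
  · ext n; ring
  · have h0 := integral_mul_cos_of_hasSum hβ hg 0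
    simp only [CharP.cast_eq_zero, zero_mul, Real.cos_zero, mul_one] at h0
    simp only [mul_add]
    rw [intervalIntegral.integral_add (Continuous.intervalIntegrable (by fun_prop) _ _)
      (Continuous.intervalIntegrable (by fun_prop) _ _), intervalIntegral.integral_mul_const, h0]
    simp only [mul_comm (f _)]
    ring

/-! ### Integrals over disks -/

lemma measurableSet_sqrt_lt (a : ℝ) : MeasurableSet {p : ℝ × ℝ | √(p.1 ^ 2 + p.2 ^ 2) < a} :=
  measurableSet_lt (by fun_prop) measurable_const

lemma integrable_indicator_disk {a C : ℝ} {F : ℝ × ℝ → ℝ} (hF : Measurable F)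
    (hC : ∀ p : ℝ × ℝ, √(p.1 ^ 2 + p.2 ^ 2) < a → |F p| ≤ C) :
    Integrable ({p : ℝ × ℝ | √(p.1 ^ 2 + p.2 ^ 2) < a}.indicator F) := by
  rw [integrable_indicator_iff (measurableSet_sqrt_lt a)]
  refine IntegrableOn.of_bound (C := C) ?_ hF.aestronglyMeasurable
    ((ae_restrict_iff' (measurableSet_sqrt_lt a)).2 (ae_of_all _ hC))
  have hsub : {p : ℝ × ℝ | √(p.1 ^ 2 + p.2 ^ 2) < a} ⊆ Icc (-a) a ×ˢ Icc (-a) a := by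
    intro p (hp : √(p.1 ^ 2 + p.2 ^ 2) < a)
    have h1 : |p.1| ≤ √(p.1 ^ 2 + p.2 ^ 2) := Real.abs_le_sqrt (by nlinarith)
    have h2 : |p.2| ≤ √(p.1 ^ 2 + p.2 ^ 2) := Real.abs_le_sqrt (by nlinarith)
    exact ⟨abs_le.1 (h1.trans hp.le), abs_le.1 (h2.trans hp.le)⟩
  exact (measure_mono hsub).trans_lt (isCompact_Icc.prod isCompact_Icc).measure_lt_top

lemma sqrt_polar {r : ℝ} (hr : 0 ≤ r) (θ : ℝ) :
    √((r * Real.cos θ) ^ 2 + (r * Real.sin θ) ^ 2) = r := by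
  rw [show (r * Real.cos θ) ^ 2 + (r * Real.sin θ) ^ 2 =
    r ^ 2 * (Real.sin θ ^ 2 + Real.cos θ ^ 2) by ring, Real.sin_sq_add_cos_sq, mul_one,
    Real.sqrt_sq hr]

/-- Radial integrability is recorded along with the value because the radial integral is later split
into a sum. -/
lemma integral_disk_polar {a C : ℝ} (ha : 0 ≤ a) {F : ℝ × ℝ → ℝ} (hF : Measurable F)
    (hC : ∀ p : ℝ × ℝ, √(p.1 ^ 2 + p.2 ^ 2) < a → |F p| ≤ C) :
    IntegrableOn (fun r => r * ∫ θ in (-Real.pi)..Real.pi,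
      F (r * Real.cos θ, r * Real.sin θ)) (Ioc 0 a) ∧
    ∫ p, {p : ℝ × ℝ | √(p.1 ^ 2 + p.2 ^ 2) < a}.indicator F p =
      ∫ r in Ioc 0 a, r * ∫ θ in (-Real.pi)..Real.pi, F (r * Real.cos θ, r * Real.sin θ) := by
  have hπ : -Real.pi ≤ Real.pi := by linarith [Real.pi_pos]
  set S : Set (ℝ × ℝ) := Ioo 0 a ×ˢ Ioo (-Real.pi) Real.pi
  have hS : MeasurableSet S := measurableSet_Ioo.prod measurableSet_Ioo
  set H : ℝ × ℝ → ℝ := fun q => q.1 * F (q.1 * Real.cos q.2, q.1 * Real.sin q.2)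
  have hH : Measurable H := by
    refine measurable_fst.mul (hF.comp ?_)
    fun_prop
  have hHi : IntegrableOn H S := by
    refine IntegrableOn.of_bound (C := a * C) ?_ hH.aestronglyMeasurable
      ((ae_restrict_iff' hS).2 (ae_of_all _ fun q hq => ?_))
    · exact (measure_mono (Set.prod_mono Ioo_subset_Icc_self Ioo_subset_Icc_self)).trans_lt
        (isCompact_Icc.prod isCompact_Icc).measure_lt_top
    · have h0 := hq.1.1.le
      have hc := hC (q.1 * Real.cos q.2, q.1 * Real.sin q.2)
        (by simpa only [sqrt_polar h0] using hq.1.2)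
      rw [norm_mul, Real.norm_of_nonneg h0]
      exact mul_le_mul hq.1.2.le hc (abs_nonneg _) ha
  have hinner (r : ℝ) : ∫ θ in Ioo (-Real.pi) Real.pi, H (r, θ) =
      r * ∫ θ in (-Real.pi)..Real.pi, F (r * Real.cos θ, r * Real.sin θ) := by
    simp only [H]
    rw [integral_const_mul, intervalIntegral.integral_of_le hπ, integral_Ioc_eq_integral_Ioo]
  constructor
  · rw [integrableOn_Ioc_iff_integrableOn_Ioo]
    simp only [← hinner]
    rw [IntegrableOn, Measure.volume_eq_prod, ← Measure.prod_restrict] at hHi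
    exact hHi.integral_prod_left
  rw [← integral_comp_polarCoord_symm]
  have e : ∀ q ∈ polarCoord.target, q.1 • {p : ℝ × ℝ | √(p.1 ^ 2 + p.2 ^ 2) < a}.indicator F
      (polarCoord.symm q) = S.indicator H q := by
    intro q hq
    rw [polarCoord_target] at hq
    have h0 : 0 < q.1 := hq.1
    rw [polarCoord_symm_apply]
    by_cases hqa : q.1 < a
    · rw [indicator_of_mem (by simpa only [mem_ofPred_eq, sqrt_polar h0.le] using hqa),
        indicator_of_mem (show q ∈ S from ⟨⟨h0, hqa⟩, hq.2⟩)]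
      rfl
    · rw [indicator_of_notMem (by simpa only [mem_ofPred_eq, sqrt_polar h0.le] using hqa),
        indicator_of_notMem (fun h : q ∈ S => hqa h.1.2), smul_zero]
  rw [setIntegral_congr_fun polarCoord.open_target.measurableSet e, setIntegral_indicator hS,
    inter_eq_self_of_subset_right (by
      rw [polarCoord_target]; exact Set.prod_mono Ioo_subset_Ioi_self subset_rfl)]
  rw [Measure.volume_eq_prod, setIntegral_prod _ hHi, integral_Ioc_eq_integral_Ioo]
  exact integral_congr_ae (ae_of_all _ hinner)

/-! ### Overlap integrals of two modes over a core -/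

/-- `K_n(G d₁) K_n(G d₂) ∫_0^a I_n(G r)² r dr`. -/
noncomputable def overlapTerm (G a d₁ d₂ : ℝ) (n : ℕ) : ℝ :=
  besselK n (G * d₁) * besselK n (G * d₂) * ∫ r in (0 : ℝ)..a, besselI n (G * r) ^ 2 * r

lemma intervalIntegrable_of_bound {a C : ℝ} (ha : 0 ≤ a) {f : ℝ → ℝ} (hf : Measurable f)
    (hC : ∀ r, 0 ≤ r → r ≤ a → |f r| ≤ C) : IntervalIntegrable f volume 0 a := by
  rw [intervalIntegrable_iff_integrableOn_Ioc_of_le ha]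
  refine IntegrableOn.of_bound (C := C) (by simp) hf.aestronglyMeasurable
    ((ae_restrict_iff' measurableSet_Ioc).2 (ae_of_all _ fun r hr => hC r hr.1.le hr.2))

lemma besselI_sq_mul_le {G a r : ℝ} (hG : 0 < G) (n : ℕ) (hr : 0 ≤ r) (hra : r ≤ a) :
    besselI n (G * r) ^ 2 * r ≤ ((G * a / 2) ^ n / n.factorial) ^ 2 * Real.exp (2 * G * a) * r := by
  have h := (le_abs_self _).trans (abs_besselI_le n (G * r))
  rw [abs_of_nonneg (mul_nonneg hG.le hr)] at h
  have h2 : besselI n (G * r) ≤ (G * a / 2) ^ n / n.factorial * Real.exp (G * a) :=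
    h.trans (by have := hr.trans hra; gcongr)
  have h3 := pow_le_pow_left₀ (besselI_nonneg n (mul_nonneg hG.le hr)) h2 2
  rw [mul_pow, ← Real.exp_nat_mul] at h3
  refine mul_le_mul_of_nonneg_right (h3.trans_eq ?_) hr
  push_cast; ring_nf

lemma intervalIntegrable_besselI_sq {G a : ℝ} (hG : 0 < G) (ha : 0 < a) (n : ℕ) :
    IntervalIntegrable (fun r => besselI n (G * r) ^ 2 * r) volume 0 a := by
  refine intervalIntegrable_of_bound ha.le
    (C := ((G * a / 2) ^ n / n.factorial) ^ 2 * Real.exp (2 * G * a) * a)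
    ((((measurable_besselI n).comp (measurable_const_mul G)).pow_const 2).mul measurable_id)
    fun r hr hra => ?_
  rw [abs_of_nonneg (mul_nonneg (sq_nonneg _) hr)]
  exact (besselI_sq_mul_le hG n hr hra).trans (by gcongr)

lemma integral_besselI_sq_nonneg {a : ℝ} (G : ℝ) (ha : 0 < a) (n : ℕ) :
    0 ≤ ∫ r in (0 : ℝ)..a, besselI n (G * r) ^ 2 * r :=
  intervalIntegral.integral_nonneg ha.le fun _ hr => mul_nonneg (sq_nonneg _) hr.1

lemma integral_besselI_sq_le {G a : ℝ} (hG : 0 < G) (ha : 0 < a) (n : ℕ) :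
    ∫ r in (0 : ℝ)..a, besselI n (G * r) ^ 2 * r ≤
      ((G * a / 2) ^ n / n.factorial) ^ 2 * Real.exp (2 * G * a) * (a ^ 2 / 2) := by
  refine (intervalIntegral.integral_mono_on ha.le (intervalIntegrable_besselI_sq hG ha n)
    (Continuous.intervalIntegrable (by fun_prop) _ _)
    fun r hr => besselI_sq_mul_le hG n hr.1 hr.2).trans_eq ?_
  rw [intervalIntegral.integral_const_mul, integral_id]
  ring

lemma overlapTerm_nonneg (G : ℝ) {a : ℝ} (ha : 0 < a) (d₁ d₂ : ℝ) (n : ℕ) :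
    0 ≤ overlapTerm G a d₁ d₂ n :=
  mul_nonneg (mul_nonneg (besselK_nonneg _ _) (besselK_nonneg _ _))
    (integral_besselI_sq_nonneg G ha n)

/-- The powers of `G` cancel between the `K` and `I` bounds, and `(n!/(n+1)!)²` leaves `1/(n+1)²`.
The `1/8` is one factor `1/2` from each `K` and one from `∫ r dr = a²/2`. -/
lemma overlapTerm_succ_le {G a d₁ d₂ : ℝ} (hG : 0 < G) (ha : 0 < a) (h₁ : 0 < d₁) (h₂ : 0 < d₂)
    (n : ℕ) : overlapTerm G a d₁ d₂ (n + 1) ≤ Real.exp (2 * G * a) * a ^ 2 / 8 *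
      ((a ^ 2 / (d₁ * d₂)) ^ (n + 1) / ((n + 1 : ℕ) : ℝ) ^ 2) := by
  have k1 := besselK_succ_le n (mul_pos hG h₁)
  have k2 := besselK_succ_le n (mul_pos hG h₂)
  have hI := integral_besselI_sq_le hG ha (n + 1)
  calc overlapTerm G a d₁ d₂ (n + 1)
      ≤ ((2 / (G * d₁)) ^ (n + 1) * n.factorial / 2) *
        ((2 / (G * d₂)) ^ (n + 1) * n.factorial / 2) *
        (((G * a / 2) ^ (n + 1) / (n + 1).factorial) ^ 2 * Real.exp (2 * G * a) * (a ^ 2 / 2)) :=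
        mul_le_mul (mul_le_mul k1 k2 (besselK_nonneg _ _) (by positivity)) hI
          (integral_besselI_sq_nonneg G ha _) (by positivity)
    _ = _ := by
        have e : (a ^ 2 / (d₁ * d₂)) ^ (n + 1) = (2 / (G * d₁)) ^ (n + 1) *
            (2 / (G * d₂)) ^ (n + 1) * ((G * a / 2) ^ (n + 1)) ^ 2 := by
          rw [← pow_mul, mul_comm (n + 1) 2, pow_mul, ← mul_pow, ← mul_pow]
          congr 1; field_simp
        rw [e, Nat.factorial_succ]
        push_cast
        field_simp
        norm_num

lemma overlapTerm_zero_le {G a d₁ d₂ : ℝ} (hG : 0 < G) (ha : 0 < a) (h₁ : 0 < d₁) (h₂ : 0 < d₂) :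
    overlapTerm G a d₁ d₂ 0 ≤ Real.exp (2 * G * a) / (2 * G ^ 2) * (a ^ 2 / (d₁ * d₂)) := by
  calc overlapTerm G a d₁ d₂ 0
      ≤ (1 / (G * d₁)) * (1 / (G * d₂)) *
        (((G * a / 2) ^ 0 / (0).factorial) ^ 2 * Real.exp (2 * G * a) * (a ^ 2 / 2)) :=
        mul_le_mul (mul_le_mul (besselK_zero_le (mul_pos hG h₁)) (besselK_zero_le (mul_pos hG h₂))
          (besselK_nonneg _ _) (by positivity)) (integral_besselI_sq_le hG ha 0)
          (integral_besselI_sq_nonneg G ha _) (by positivity)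
    _ = _ := by simp; field_simp

lemma summable_one_div_succ_sq : Summable fun n : ℕ => 1 / ((n + 1 : ℕ) : ℝ) ^ 2 :=
  (summable_nat_add_iff 1).2 (Real.summable_one_div_nat_pow.2 one_lt_two)

/-- Keeps a single power of `q`, common to all `n`: `1/(n+1)²` gives summability in `n`, while `q`
retains the decay `1/(d₁ d₂)` needed to sum over cores. -/
lemma overlapTerm_succ_le' {G a d₁ d₂ : ℝ} (hG : 0 < G) (ha : 0 < a) (h₁ : 0 < d₁) (h₂ : 0 < d₂)
    (hq : a ^ 2 / (d₁ * d₂) ≤ 1) (n : ℕ) :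
    overlapTerm G a d₁ d₂ (n + 1) ≤
      Real.exp (2 * G * a) * a ^ 2 / 8 * (a ^ 2 / (d₁ * d₂)) * (1 / ((n + 1 : ℕ) : ℝ) ^ 2) := by
  refine (overlapTerm_succ_le hG ha h₁ h₂ n).trans ?_
  have : (a ^ 2 / (d₁ * d₂)) ^ (n + 1) ≤ a ^ 2 / (d₁ * d₂) :=
    pow_le_of_le_one (by positivity) hq (Nat.succ_ne_zero n)
  rw [mul_assoc (Real.exp (2 * G * a) * a ^ 2 / 8), mul_one_div]
  gcongr

lemma summable_overlapTerm_succ {G a d₁ d₂ : ℝ} (hG : 0 < G) (ha : 0 < a) (h₁ : 0 < d₁)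
    (h₂ : 0 < d₂) (hq : a ^ 2 / (d₁ * d₂) ≤ 1) :
    Summable fun n => overlapTerm G a d₁ d₂ (n + 1) :=
  .of_nonneg_of_le (fun _ => overlapTerm_nonneg G ha d₁ d₂ _)
    (overlapTerm_succ_le' hG ha h₁ h₂ hq) (summable_one_div_succ_sq.mul_left _)

lemma summable_pow_mul_overlapTerm {G a d₁ d₂ σ : ℝ} (hG : 0 < G) (ha : 0 < a) (h₁ : 0 < d₁)
    (h₂ : 0 < d₂) (hq : a ^ 2 / (d₁ * d₂) ≤ 1) (hσ : |σ| = 1) :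
    Summable fun n => σ ^ n * overlapTerm G a d₁ d₂ n := by
  refine .of_norm_bounded ((summable_nat_add_iff 1).1
    (summable_overlapTerm_succ hG ha h₁ h₂ hq)) fun n => ?_
  rw [norm_mul, norm_pow, Real.norm_eq_abs, hσ, one_pow, one_mul,
    Real.norm_of_nonneg (overlapTerm_nonneg G ha d₁ d₂ n)]

/-- `∑_{n ∈ ℤ} σ^n T_n`, with `T_n` the overlap terms. -/
noncomputable def overlapSum (G a d₁ d₂ σ : ℝ) : ℝ :=
  overlapTerm G a d₁ d₂ 0 + 2 * ∑' n : ℕ, σ ^ (n + 1) * overlapTerm G a d₁ d₂ (n + 1)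

lemma abs_overlapSum_le {G a d₁ d₂ σ : ℝ} (hG : 0 < G) (ha : 0 < a) (h₁ : 0 < d₁)
    (h₂ : 0 < d₂) (hq : a ^ 2 / (d₁ * d₂) ≤ 1) (hσ : |σ| = 1) :
    |overlapSum G a d₁ d₂ σ| ≤ (Real.exp (2 * G * a) / (2 * G ^ 2) +
      2 * (Real.exp (2 * G * a) * a ^ 2 / 8 * ∑' n : ℕ, 1 / ((n + 1 : ℕ) : ℝ) ^ 2)) *
        (a ^ 2 / (d₁ * d₂)) := by
  have h0 : |overlapTerm G a d₁ d₂ 0| ≤ _ :=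
    (abs_of_nonneg (overlapTerm_nonneg G ha d₁ d₂ 0)).trans_le (overlapTerm_zero_le hG ha h₁ h₂)
  have hs : |∑' n : ℕ, σ ^ (n + 1) * overlapTerm G a d₁ d₂ (n + 1)| ≤
      Real.exp (2 * G * a) * a ^ 2 / 8 * (a ^ 2 / (d₁ * d₂)) *
        ∑' n : ℕ, 1 / ((n + 1 : ℕ) : ℝ) ^ 2 := by
    refine tsum_of_norm_bounded (f := fun n : ℕ => σ ^ (n + 1) * overlapTerm G a d₁ d₂ (n + 1))
      (summable_one_div_succ_sq.hasSum.mul_left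
      (Real.exp (2 * G * a) * a ^ 2 / 8 * (a ^ 2 / (d₁ * d₂)))) fun n => ?_
    rw [norm_mul, norm_pow, Real.norm_eq_abs, hσ, one_pow, one_mul,
      Real.norm_of_nonneg (overlapTerm_nonneg G ha d₁ d₂ _)]
    exact overlapTerm_succ_le' hG ha h₁ h₂ hq n
  rw [overlapSum]
  refine (abs_add_le _ _).trans ?_
  rw [abs_mul, abs_two]
  linarith

/-- Graf's addition theorem with centre `σ d`, `σ = ±1`. -/
lemma hasSum_graf_signed {r d σ : ℝ} (hr : 0 ≤ r) (hrd : r < d) (hσ : σ = 1 ∨ σ = -1) (θ : ℝ) :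
    HasSum (fun n : ℕ => 2 * (besselI n r * besselK n d * σ ^ n) * Real.cos (n * θ))
      (besselK 0 (√((r * Real.cos θ - σ * d) ^ 2 + (r * Real.sin θ) ^ 2)) +
        besselI 0 r * besselK 0 d) := by
  rcases hσ with rfl | rfl
  · simpa [mul_assoc] using hasSum_besselI_mul_besselK_mul_cos hr hrd θ
  -- Reflection `θ ↦ π - θ` moves the centre to `-d` and multiplies the `n`-th cosine by `(-1)^n`.
  · convert! hasSum_besselI_mul_besselK_mul_cos hr hrd (Real.pi - θ) using 1
    · ext n
      rw [mul_sub, Real.cos_nat_mul_pi_sub]; ring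
    · rw [Real.cos_pi_sub, Real.sin_pi_sub]
      ring_nf

/-- The field at `p` of a mode centred at `(c, 0)`, outside its core. -/
noncomputable def cladding (G c : ℝ) (p : ℝ × ℝ) : ℝ := besselK 0 (G * √((p.1 - c) ^ 2 + p.2 ^ 2))

lemma measurable_cladding (G c : ℝ) : Measurable (cladding G c) :=
  (measurable_besselK 0).comp (by fun_prop)

lemma cladding_nonneg (G c : ℝ) (p : ℝ × ℝ) : 0 ≤ cladding G c p := besselK_nonneg _ _

lemma hasSum_cladding {G r d σ : ℝ} (hG : 0 < G) (hr : 0 ≤ r) (hrd : r < d) (hσ : σ = 1 ∨ σ = -1)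
    (θ : ℝ) :
    HasSum (fun n : ℕ => 2 * (besselI n (G * r) * besselK n (G * d) * σ ^ n) * Real.cos (n * θ))
      (cladding G (σ * d) (r * Real.cos θ, r * Real.sin θ) +
        2 * (besselI 0 (G * r) * besselK 0 (G * d) * σ ^ 0) / 2) := by
  convert! hasSum_graf_signed (mul_nonneg hG.le hr) (mul_lt_mul_of_pos_left hrd hG) hσ θ using 2
  · rw [cladding, ← Real.sqrt_sq (mul_nonneg hG.le (Real.sqrt_nonneg _)), mul_pow,
      Real.sq_sqrt (by positivity)]
    congr 2; ring
  · ring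

lemma summable_cladding {G r d σ : ℝ} (hG : 0 < G) (hr : 0 ≤ r) (hrd : r < d)
    (hσ : σ = 1 ∨ σ = -1) :
    Summable fun n : ℕ => |2 * (besselI n (G * r) * besselK n (G * d) * σ ^ n)| := by
  refine (summable_besselI_mul_besselK (mul_nonneg hG.le hr)
    (mul_lt_mul_of_pos_left hrd hG)).abs.congr fun n => ?_
  have : |σ| = 1 := by rcases hσ with rfl | rfl <;> simp
  simp only [abs_mul, abs_pow, this]; ring

/-- Parseval applied to the two Graf expansions; only the product `σ₁σ₂` of the sides survives. -/
lemma hasSum_circle_integral {G r d₁ d₂ σ₁ σ₂ : ℝ} (hG : 0 < G) (hr : 0 ≤ r) (h₁ : r < d₁)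
    (h₂ : r < d₂) (hσ₁ : σ₁ = 1 ∨ σ₁ = -1) (hσ₂ : σ₂ = 1 ∨ σ₂ = -1) :
    HasSum (fun n : ℕ => 4 * Real.pi * ((σ₁ * σ₂) ^ n *
        (besselK n (G * d₁) * besselK n (G * d₂) * besselI n (G * r) ^ 2)))
      ((∫ θ in (-Real.pi)..Real.pi, cladding G (σ₁ * d₁) (r * Real.cos θ, r * Real.sin θ) *
        cladding G (σ₂ * d₂) (r * Real.cos θ, r * Real.sin θ)) +
        2 * Real.pi * (besselK 0 (G * d₁) * besselK 0 (G * d₂) * besselI 0 (G * r) ^ 2)) := by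
  convert! hasSum_integral_mul_of_hasSum_cos (summable_cladding hG hr h₁ hσ₁)
    (summable_cladding hG hr h₂ hσ₂) (hasSum_cladding hG hr h₁ hσ₁)
    (hasSum_cladding hG hr h₂ hσ₂) using 1
  · ext n; ring
  · ring

lemma circle_integral_cladding {G r d σ : ℝ} (hG : 0 < G) (hr : 0 ≤ r) (hrd : r < d)
    (hσ : σ = 1 ∨ σ = -1) :
    ∫ θ in (-Real.pi)..Real.pi, cladding G (σ * d) (r * Real.cos θ, r * Real.sin θ) =
      2 * Real.pi * (besselI 0 (G * r) * besselK 0 (G * d)) := by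
  have := integral_mul_cos_of_hasSum (summable_cladding hG hr hrd hσ)
    (hasSum_cladding hG hr hrd hσ) 0
  simp only [CharP.cast_eq_zero, zero_mul, Real.cos_zero, mul_one, pow_zero] at this
  rw [this]; ring

/-- The disk of radius `a` about the origin. -/
def disk (a : ℝ) : Set (ℝ × ℝ) := {p | √(p.1 ^ 2 + p.2 ^ 2) < a}

/-- By the triangle inequality, a core at distance at least `2a` is disjoint from this disk; its
mode is therefore in the cladding branch there, away from the singularity of `K_0`. -/
lemma sub_lt_dist {a c : ℝ} {p : ℝ × ℝ} (hp : p ∈ disk a) (hc : 2 * a ≤ |c|) :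
    a < √((p.1 - c) ^ 2 + p.2 ^ 2) := by
  have hp' : √(p.1 ^ 2 + p.2 ^ 2) < a := hp
  have h1 : |p.1| ≤ √(p.1 ^ 2 + p.2 ^ 2) := Real.abs_le_sqrt (by nlinarith)
  have h2 : |p.1 - c| ≤ √((p.1 - c) ^ 2 + p.2 ^ 2) := Real.abs_le_sqrt (by nlinarith)
  have h3 : |c| ≤ |p.1| + |p.1 - c| := by
    have := abs_sub p.1 (p.1 - c)
    rwa [sub_sub_cancel] at this
  linarith

lemma cladding_le {G a c : ℝ} {p : ℝ × ℝ} (hG : 0 < G) (ha : 0 < a) (hp : p ∈ disk a)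
    (hc : 2 * a ≤ |c|) : |cladding G c p| ≤ besselK 0 (G * a) := by
  rw [abs_of_nonneg (cladding_nonneg G c p)]
  exact besselK_zero_anti (mul_pos hG ha)
    (mul_le_mul_of_nonneg_left (sub_lt_dist hp hc).le hG.le)

lemma abs_sign_mul {σ d : ℝ} (hd : 0 < d) (hσ : σ = 1 ∨ σ = -1) : |σ * d| = d := by
  rcases hσ with rfl | rfl <;> simp [abs_of_pos hd]

lemma integrable_disk_cladding_mul {G a c₁ c₂ : ℝ} (hG : 0 < G) (ha : 0 < a) (h₁ : 2 * a ≤ |c₁|)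
    (h₂ : 2 * a ≤ |c₂|) :
    Integrable ((disk a).indicator fun p => cladding G c₁ p * cladding G c₂ p) :=
  integrable_indicator_disk ((measurable_cladding G c₁).mul (measurable_cladding G c₂))
    fun _ hp => (abs_mul _ _).trans_le <| mul_le_mul (cladding_le hG ha hp h₁)
      (cladding_le hG ha hp h₂) (abs_nonneg _) (besselK_nonneg _ _)

lemma integral_disk_cladding_mul {G a d₁ d₂ σ₁ σ₂ : ℝ} (hG : 0 < G) (ha : 0 < a)
    (h₁ : 2 * a ≤ d₁) (h₂ : 2 * a ≤ d₂) (hσ₁ : σ₁ = 1 ∨ σ₁ = -1) (hσ₂ : σ₂ = 1 ∨ σ₂ = -1) :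
    ∫ p, (disk a).indicator (fun p => cladding G (σ₁ * d₁) p * cladding G (σ₂ * d₂) p) p =
      2 * Real.pi * overlapSum G a d₁ d₂ (σ₁ * σ₂) := by
  have hd₁ : 0 < d₁ := by linarith
  have hd₂ : 0 < d₂ := by linarith
  have hσ : |σ₁ * σ₂| = 1 := by rcases hσ₁ with rfl | rfl <;> rcases hσ₂ with rfl | rfl <;> simp
  have hq : a ^ 2 / (d₁ * d₂) ≤ 1 := (div_le_one (by positivity)).2 (by nlinarith)
  have hsum := summable_pow_mul_overlapTerm hG ha hd₁ hd₂ hq hσ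
  have hC : ∀ p : ℝ × ℝ, p ∈ disk a → |cladding G (σ₁ * d₁) p * cladding G (σ₂ * d₂) p| ≤
      besselK 0 (G * a) * besselK 0 (G * a) := fun p hp => (abs_mul _ _).trans_le <|
    mul_le_mul (cladding_le hG ha hp (by rwa [abs_sign_mul hd₁ hσ₁]))
      (cladding_le hG ha hp (by rwa [abs_sign_mul hd₂ hσ₂])) (abs_nonneg _) (besselK_nonneg _ _)
  obtain ⟨hpi, hpolar⟩ := integral_disk_polar ha.le
    (F := fun p => cladding G (σ₁ * d₁) p * cladding G (σ₂ * d₂) p)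
    ((measurable_cladding G (σ₁ * d₁)).mul (measurable_cladding G (σ₂ * d₂))) hC
  set t : ℕ → ℝ → ℝ := fun n r => 4 * Real.pi * (σ₁ * σ₂) ^ n *
    (besselK n (G * d₁) * besselK n (G * d₂)) * (besselI n (G * r) ^ 2 * r)
  have hti (n : ℕ) : Integrable (t n) (volume.restrict (Ioc 0 a)) :=
    ((intervalIntegrable_iff_integrableOn_Ioc_of_le ha.le).1
      (intervalIntegrable_besselI_sq hG ha n)).const_mul _
  have htv (n : ℕ) : ∫ r in Ioc 0 a, t n r =
      4 * Real.pi * ((σ₁ * σ₂) ^ n * overlapTerm G a d₁ d₂ n) := by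
    rw [integral_const_mul, overlapTerm, intervalIntegral.integral_of_le ha.le]; ring
  have htn (n : ℕ) : ∫ r in Ioc 0 a, ‖t n r‖ = 4 * Real.pi * overlapTerm G a d₁ d₂ n := by
    rw [overlapTerm, intervalIntegral.integral_of_le ha.le, ← integral_const_mul,
      ← integral_const_mul]
    refine setIntegral_congr_fun measurableSet_Ioc fun r hr => ?_
    simp only [t, norm_mul, norm_pow, Real.norm_eq_abs, hσ, ← abs_mul]
    simp only [abs_mul, sq_abs, abs_of_pos hr.1, abs_of_nonneg (besselK_nonneg _ _),
      abs_of_pos Real.pi_pos, one_pow]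
    norm_num
    ring
  have hts := hasSum_integral_of_summable_integral_norm hti <| by
    simp only [htn]
    exact Summable.mul_left _ ((summable_nat_add_iff 1).1
      (summable_overlapTerm_succ hG ha hd₁ hd₂ hq))
  simp only [htv] at hts
  have hval : ∫ r in Ioc 0 a, ∑' n, t n r =
      (∫ p, (disk a).indicator (fun p => cladding G (σ₁ * d₁) p * cladding G (σ₂ * d₂) p) p) +
        2 * Real.pi * overlapTerm G a d₁ d₂ 0 := by
    have hr : ∀ r ∈ Ioc 0 a, ∑' n, t n r = r * (∫ θ in (-Real.pi)..Real.pi,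
        cladding G (σ₁ * d₁) (r * Real.cos θ, r * Real.sin θ) *
          cladding G (σ₂ * d₂) (r * Real.cos θ, r * Real.sin θ)) +
        2 * Real.pi * (besselK 0 (G * d₁) * besselK 0 (G * d₂)) *
          (besselI 0 (G * r) ^ 2 * r) := by
      intro r hr
      have := ((hasSum_circle_integral hG hr.1.le (by linarith [hr.2]) (by linarith [hr.2])
        hσ₁ hσ₂ (d₁ := d₁) (d₂ := d₂)).mul_right r).tsum_eq
      calc _ = _ := tsum_congr fun n => by simp only [t]; ring
        _ = _ := this
        _ = _ := by ring
    rw [setIntegral_congr_fun measurableSet_Ioc hr, integral_add hpi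
      (((intervalIntegrable_iff_integrableOn_Ioc_of_le ha.le).1
        (intervalIntegrable_besselI_sq hG ha 0)).const_mul _), integral_const_mul, overlapTerm,
      intervalIntegral.integral_of_le ha.le, disk, hpolar]
    ring
  rw [hval] at hts
  -- Two evaluations of the same radial integral: `4π ∑ σ^n T_n` equals the disk integral plus `2π
  -- T_0`.
  have e := (hsum.hasSum.mul_left (4 * Real.pi)).unique hts
  rw [hsum.tsum_eq_zero_add] at e
  rw [overlapSum]
  simp only [pow_zero, one_mul] at e
  linarith

lemma abs_besselJ_zero_le {L a r : ℝ} (hL : 0 ≤ L) (hr : 0 ≤ r) (hra : r ≤ a) :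
    |besselJ 0 (L * r)| ≤ Real.exp (L * a) := by
  have h := abs_besselJ_le 0 (L * r)
  rw [abs_of_nonneg (mul_nonneg hL hr)] at h
  simp only [pow_zero, Nat.factorial_zero, Nat.cast_one, div_one, one_mul] at h
  exact h.trans (Real.exp_le_exp.2 (by gcongr))

/-- The field at `p` of a mode centred at the origin, inside its core. -/
noncomputable def coreField (L : ℝ) (p : ℝ × ℝ) : ℝ := besselJ 0 (L * √(p.1 ^ 2 + p.2 ^ 2))

lemma measurable_coreField (L : ℝ) : Measurable (coreField L) :=
  (measurable_besselJ 0).comp (by fun_prop)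

lemma abs_coreField_mul_cladding_le {L G a c : ℝ} {p : ℝ × ℝ} (hL : 0 ≤ L) (hG : 0 < G)
    (ha : 0 < a) (hc : 2 * a ≤ |c|) (hp : p ∈ disk a) :
    |coreField L p * cladding G c p| ≤ Real.exp (L * a) * besselK 0 (G * a) := by
  rw [abs_mul]
  exact mul_le_mul (abs_besselJ_zero_le hL (Real.sqrt_nonneg _) (show _ < a from hp).le)
    (cladding_le hG ha hp hc) (abs_nonneg _) (Real.exp_pos _).le

lemma integrable_disk_coreField_mul_cladding {L G a c : ℝ} (hL : 0 ≤ L) (hG : 0 < G)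
    (ha : 0 < a) (hc : 2 * a ≤ |c|) :
    Integrable ((disk a).indicator fun p => coreField L p * cladding G c p) :=
  integrable_indicator_disk ((measurable_coreField L).mul (measurable_cladding G c))
    fun _ hp => abs_coreField_mul_cladding_le hL hG ha hc hp

/-- The core field is constant on circles, so only the zeroth cosine coefficient of the cladding
field contributes. -/
lemma integral_disk_coreField_mul_cladding {L G a d σ : ℝ} (hL : 0 ≤ L) (hG : 0 < G)
    (ha : 0 < a) (hd : 2 * a ≤ d) (hσ : σ = 1 ∨ σ = -1) :
    ∫ p, (disk a).indicator (fun p => coreField L p * cladding G (σ * d) p) p =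
      2 * Real.pi * (besselK 0 (G * d) *
        ∫ r in (0 : ℝ)..a, besselJ 0 (L * r) * besselI 0 (G * r) * r) := by
  have hc : 2 * a ≤ |σ * d| := by rwa [abs_sign_mul (by linarith) hσ]
  rw [disk, (integral_disk_polar ha.le (F := fun p => coreField L p * cladding G (σ * d) p)
    ((measurable_coreField L).mul (measurable_cladding G (σ * d)))
    fun _ hp => abs_coreField_mul_cladding_le hL hG ha hc hp).2,
    intervalIntegral.integral_of_le ha.le, ← integral_const_mul, ← integral_const_mul]
  refine setIntegral_congr_fun measurableSet_Ioc fun r hr => ?_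
  have h (θ : ℝ) : coreField L (r * Real.cos θ, r * Real.sin θ) = besselJ 0 (L * r) := by
    rw [coreField, sqrt_polar hr.1.le]
  simp only [h]
  rw [intervalIntegral.integral_const_mul,
    circle_integral_cladding hG hr.1.le (by linarith [hr.2]) hσ]
  ring

/-! ### Tools for summing over the cores -/

lemma integrable_tsum_of_summable_integral_norm {X ι : Type*} [MeasurableSpace X] [Countable ι]
    {μ : Measure X} {F : ι → X → ℝ} (hF : ∀ i, Integrable (F i) μ)
    (hs : Summable fun i => ∫ x, ‖F i x‖ ∂μ) : Integrable (fun x => ∑' i, F i x) μ := by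
  refine ⟨(AEMeasurable.tsum fun i => (hF i).aemeasurable).aestronglyMeasurable, ?_⟩
  calc ∫⁻ x, ‖∑' i, F i x‖ₑ ∂μ ≤ ∫⁻ x, ∑' i, ‖F i x‖ₑ ∂μ :=
        lintegral_mono fun x => enorm_tsum_le_tsum_enorm
    _ = ∑' i, ENNReal.ofReal (∫ x, ‖F i x‖ ∂μ) := by
        rw [lintegral_tsum fun i => (hF i).aestronglyMeasurable.enorm]
        exact tsum_congr fun i => (ofReal_integral_norm_eq_lintegral_enorm (hF i)).symm
    _ < ⊤ := by
        rw [← ENNReal.ofReal_tsum_of_nonneg (fun i => integral_nonneg fun x => norm_nonneg _) hs]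
        exact ENNReal.ofReal_lt_top

/-- From `1/(xy) ≤ 1/x² + 1/y²`; the convention `1/0 = 0` makes the indices `l = i, j` harmless. -/
lemma summable_one_div_abs_mul_int (i j : ℤ) :
    Summable fun l : ℤ => 1 / |((l : ℝ) - i) * ((l : ℝ) - j)| := by
  have h (m : ℤ) : Summable fun l : ℤ => 1 / ((l : ℝ) - m) ^ 2 := by
    have := (Equiv.subRight m).summable_iff.2 (Real.summable_one_div_int_pow.2 one_lt_two)
    simpa [Function.comp_def] using this
  refine .of_nonneg_of_le (fun l => by positivity) (fun l => ?_) ((h i).add (h j))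
  rw [abs_mul, ← sq_abs ((l : ℝ) - i), ← sq_abs ((l : ℝ) - j)]
  generalize |(l : ℝ) - i| = x, |(l : ℝ) - j| = y
  rw [one_div, one_div, one_div, mul_inv, ← inv_pow, ← inv_pow]
  nlinarith [sq_nonneg (x⁻¹ - y⁻¹), sq_nonneg (x⁻¹ + y⁻¹)]

lemma overlapTerm_comm (G a d₁ d₂ : ℝ) (n : ℕ) :
    overlapTerm G a d₁ d₂ n = overlapTerm G a d₂ d₁ n := by
  rw [overlapTerm, overlapTerm, mul_comm (besselK n (G * d₁))]

lemma overlapSum_comm (G a d₁ d₂ σ : ℝ) : overlapSum G a d₁ d₂ σ = overlapSum G a d₂ d₁ σ := by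
  simp only [overlapSum, overlapTerm_comm G a d₁ d₂]

lemma sign_cast_mul_abs (x : ℤ) : ((x.sign : ℤ) : ℝ) * |(x : ℝ)| = x := by
  exact_mod_cast Int.sign_mul_abs x

lemma sign_cast_eq {x : ℤ} (hx : x ≠ 0) : ((x.sign : ℤ) : ℝ) = 1 ∨ ((x.sign : ℤ) : ℝ) = -1 := by
  rcases hx.lt_or_gt with h | h
  · right; simp [Int.sign_eq_neg_one_of_neg h]
  · left; simp [Int.sign_eq_one_of_pos h]

lemma one_le_abs_cast {x : ℤ} (hx : x ≠ 0) : (1 : ℝ) ≤ |(x : ℝ)| := by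
  exact_mod_cast Int.one_le_abs hx

namespace ArrayData

variable {P : ArrayData}

lemma k_pos (hn0 : 0 < P.n0) (hwl : 0 < P.wl) : 0 < P.k := by
  unfold k; have := Real.pi_pos; positivity

lemma Gam_pos (hn0 : 0 < P.n0) (hwl : 0 < P.wl) (hbeta0 : 0 < P.beta0) : 0 < P.Gam := by
  have := k_pos hn0 hwl
  exact Real.sqrt_pos.2 (by positivity)

lemma term_eq (P : ArrayData) (l s : ℤ) (m : ℕ) :
    P.term l s m = overlapTerm P.Gam P.a (|(l : ℝ)| * P.D) (|(l : ℝ) - s| * P.D) m := by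
  simp only [term, overlapTerm, mul_assoc]

lemma varsigma_eq (P : ArrayData) (l s : ℤ) :
    P.varsigma l s = overlapSum P.Gam P.a (|(l : ℝ)| * P.D) (|(l : ℝ) - s| * P.D) 1 := by
  simp only [varsigma, overlapSum, term_eq, one_pow, one_mul]

lemma zeta_eq (P : ArrayData) (l s : ℤ) :
    P.zeta l s = overlapSum P.Gam P.a (|(l : ℝ)| * P.D) (|(l : ℝ) - s| * P.D) (-1) := by
  simp only [zeta, overlapSum, term_eq]

lemma spacing_pos (ha : 0 < P.a) (hD : 2 * P.a ≤ P.D) : 0 < P.D := by linarith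

lemma two_mul_a_le (ha : 0 < P.a) (hD : 2 * P.a ≤ P.D) {x : ℤ} (hx : x ≠ 0) :
    2 * P.a ≤ |(x : ℝ)| * P.D := by
  nlinarith [one_le_abs_cast hx, spacing_pos ha hD]

lemma ratio_lt_one (ha : 0 < P.a) (hD : 2 * P.a ≤ P.D) {x y : ℤ} (hx : x ≠ 0) (hy : y ≠ 0) :
    P.a ^ 2 / ((|(x : ℝ)| * P.D) * (|(y : ℝ)| * P.D)) < 1 := by
  have h1 := two_mul_a_le ha hD hx
  have h2 := two_mul_a_le ha hD hy
  rw [div_lt_one (mul_pos (by linarith) (by linarith))]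
  nlinarith

lemma ratio_eq (P : ArrayData) (x y : ℝ) :
    P.a ^ 2 / ((|x| * P.D) * (|y| * P.D)) = P.a ^ 2 / (|x * y| * P.D ^ 2) := by
  rw [abs_mul]; ring_nf

/-- A summable bound for the overlap sums of the cores `i` and `j` over the cores `l`. -/
lemma exists_abs_overlapSum_le (ha : 0 < P.a) (hD : 2 * P.a ≤ P.D) (hG : 0 < P.Gam) :
    ∃ C : ℝ, ∀ x y : ℤ, x ≠ 0 → y ≠ 0 → ∀ σ : ℝ, |σ| = 1 →
      |overlapSum P.Gam P.a (|(x : ℝ)| * P.D) (|(y : ℝ)| * P.D) σ| ≤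
        C * (1 / |(x : ℝ) * y|) := by
  refine ⟨(Real.exp (2 * P.Gam * P.a) / (2 * P.Gam ^ 2) + 2 * (Real.exp (2 * P.Gam * P.a) *
    P.a ^ 2 / 8 * ∑' n : ℕ, 1 / ((n + 1 : ℕ) : ℝ) ^ 2)) * (P.a ^ 2 / P.D ^ 2),
    fun x y hx hy σ hσ => ?_⟩
  have h1 := two_mul_a_le ha hD hx
  have h2 := two_mul_a_le ha hD hy
  refine (abs_overlapSum_le hG ha (by linarith) (by linarith)
    (ratio_lt_one ha hD hx hy).le hσ).trans_eq ?_
  rw [ratio_eq, mul_assoc _ (P.a ^ 2 / P.D ^ 2), div_mul_div_comm, mul_one, mul_comm (P.D ^ 2)]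

/-! ### Core-by-core evaluation of the coupling integral -/

/-- The contribution of core `l` to `kappaIntegrand`. -/
noncomputable def coreIntegrand (P : ArrayData) (i j l : ℤ) (p : ℝ × ℝ) : ℝ :=
  P.mode i p * (P.k * P.indexPert l p / P.n0) * P.mode j p

lemma kappaIntegrand_eq_tsum (P : ArrayData) (i j : ℤ) :
    P.kappaIntegrand i j = fun p => ∑' l : {l : ℤ // l ≠ j}, P.coreIntegrand i j l p := by
  ext p
  simp only [coreIntegrand, tsum_mul_right, tsum_mul_left]
  rfl

/-- Centre of core `l`. -/
noncomputable def centre (P : ArrayData) (l : ℤ) : ℝ × ℝ := ((l : ℝ) * P.D, 0)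

lemma dist_eq (P : ArrayData) (m l : ℤ) (p : ℝ × ℝ) : P.dist m p =
    √(((p - P.centre l).1 - ((m - l : ℤ) : ℝ) * P.D) ^ 2 + (p - P.centre l).2 ^ 2) := by
  simp only [dist, centre, Prod.fst_sub, Prod.snd_sub, sub_zero, Int.cast_sub]
  ring_nf

lemma dist_lt_iff (P : ArrayData) (l : ℤ) (p : ℝ × ℝ) :
    P.dist l p < P.a ↔ p - P.centre l ∈ disk P.a := by
  rw [dist_eq P l l]
  simp [disk]

lemma mode_eq_cladding (ha : 0 < P.a) (hD : 2 * P.a ≤ P.D) {m l : ℤ} (hml : m - l ≠ 0)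
    {p : ℝ × ℝ} (hp : p - P.centre l ∈ disk P.a) :
    P.mode m p = P.B * cladding P.Gam (((m - l : ℤ) : ℝ) * P.D) (p - P.centre l) := by
  have h : 2 * P.a ≤ |((m - l : ℤ) : ℝ) * P.D| := by
    rw [abs_mul, abs_of_pos (spacing_pos ha hD)]
    exact two_mul_a_le ha hD hml
  rw [mode, radialMode, dist_eq P m l, if_neg (sub_lt_dist hp h).le.not_gt]
  rfl

lemma mode_eq_coreField {l : ℤ} {p : ℝ × ℝ} (hp : p - P.centre l ∈ disk P.a) :
    P.mode l p = P.A * coreField P.Lam (p - P.centre l) := by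
  rw [mode, radialMode, if_pos ((dist_lt_iff P l p).2 hp), dist_eq P l l]
  simp [coreField]

lemma coreIntegrand_eq_cladding (ha : 0 < P.a) (hD : 2 * P.a ≤ P.D) {i j l : ℤ}
    (hi : i - l ≠ 0) (hj : j - l ≠ 0) :
    P.coreIntegrand i j l = fun p => P.k * P.dn / P.n0 * P.B ^ 2 * (disk P.a).indicator (fun p =>
      cladding P.Gam (((i - l : ℤ) : ℝ) * P.D) p * cladding P.Gam (((j - l : ℤ) : ℝ) * P.D) p)
        (p - P.centre l) := by
  ext p
  by_cases hp : p - P.centre l ∈ disk P.a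
  · rw [coreIntegrand, indexPert, if_pos ((dist_lt_iff P l p).2 hp), indicator_of_mem hp,
      mode_eq_cladding ha hD hi hp, mode_eq_cladding ha hD hj hp]
    ring
  · rw [coreIntegrand, indexPert, if_neg (fun h => hp ((dist_lt_iff P l p).1 h)),
      indicator_of_notMem hp]
    simp

lemma coreIntegrand_eq_coreField (ha : 0 < P.a) (hD : 2 * P.a ≤ P.D) {i j : ℤ}
    (hj : j - i ≠ 0) :
    P.coreIntegrand i j i = fun p => P.k * P.dn / P.n0 * (P.A * P.B) *
      (disk P.a).indicator (fun p => coreField P.Lam p *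
        cladding P.Gam (((j - i : ℤ) : ℝ) * P.D) p) (p - P.centre i) := by
  ext p
  by_cases hp : p - P.centre i ∈ disk P.a
  · rw [coreIntegrand, indexPert, if_pos ((dist_lt_iff P i p).2 hp), indicator_of_mem hp,
      mode_eq_coreField hp, mode_eq_cladding ha hD hj hp]
    ring
  · rw [coreIntegrand, indexPert, if_neg (fun h => hp ((dist_lt_iff P i p).1 h)),
      indicator_of_notMem hp]
    simp

lemma offset_eq (P : ArrayData) (x : ℤ) :
    (x : ℝ) * P.D = ((x.sign : ℤ) : ℝ) * (|(x : ℝ)| * P.D) := by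
  rw [← mul_assoc, sign_cast_mul_abs]

/-- The integral of `coreIntegrand i j l` for `l ≠ j`, extended by `0` to `l = j`. -/
noncomputable def coreWeight (P : ArrayData) (i j l : ℤ) : ℝ :=
  if j - l = 0 then 0
  else if i - l = 0 then P.k * P.dn / P.n0 * (P.A * P.B) * (2 * Real.pi *
    (besselK 0 (P.Gam * (|((j - l : ℤ) : ℝ)| * P.D)) *
      ∫ r in (0 : ℝ)..P.a, besselJ 0 (P.Lam * r) * besselI 0 (P.Gam * r) * r))
  else P.k * P.dn / P.n0 * P.B ^ 2 * (2 * Real.pi *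
    overlapSum P.Gam P.a (|((i - l : ℤ) : ℝ)| * P.D) (|((j - l : ℤ) : ℝ)| * P.D)
      (((i - l) * (j - l)).sign : ℤ))

lemma integrable_coreIntegrand (ha : 0 < P.a) (hD : 2 * P.a ≤ P.D) (hG : 0 < P.Gam) (i : ℤ)
    {j l : ℤ} (hj : j - l ≠ 0) : Integrable (P.coreIntegrand i j l) := by
  have h (x : ℤ) (hx : x ≠ 0) : 2 * P.a ≤ |(x : ℝ) * P.D| := by
    rw [abs_mul, abs_of_pos (spacing_pos ha hD)]
    exact two_mul_a_le ha hD hx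
  by_cases hi : i - l = 0
  · obtain rfl : i = l := by omega
    rw [coreIntegrand_eq_coreField ha hD hj]
    exact ((integrable_disk_coreField_mul_cladding (Real.sqrt_nonneg _) hG ha
      (h _ hj)).comp_sub_right (P.centre i)).const_mul _
  · rw [coreIntegrand_eq_cladding ha hD hi hj]
    exact ((integrable_disk_cladding_mul hG ha (h _ hi) (h _ hj)).comp_sub_right
      (P.centre l)).const_mul _

lemma integral_coreIntegrand (ha : 0 < P.a) (hD : 2 * P.a ≤ P.D) (hG : 0 < P.Gam) (i : ℤ)
    {j l : ℤ} (hj : j - l ≠ 0) : ∫ p, P.coreIntegrand i j l p = P.coreWeight i j l := by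
  rw [coreWeight, if_neg hj]
  split_ifs with hi
  · obtain rfl : i = l := by omega
    rw [coreIntegrand_eq_coreField ha hD hj, integral_const_mul,
      integral_sub_right_eq_self ((disk P.a).indicator _), offset_eq,
      integral_disk_coreField_mul_cladding (L := P.Lam) (Real.sqrt_nonneg _) hG ha
        (two_mul_a_le ha hD hj) (sign_cast_eq hj)]
  · rw [coreIntegrand_eq_cladding ha hD hi hj, integral_const_mul,
      integral_sub_right_eq_self ((disk P.a).indicator _), offset_eq, offset_eq,
      integral_disk_cladding_mul hG ha (two_mul_a_le ha hD hi) (two_mul_a_le ha hD hj)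
        (sign_cast_eq hi) (sign_cast_eq hj), Int.sign_mul, Int.cast_mul]

lemma coreIntegrand_nonneg (ha : 0 < P.a) (hD : 2 * P.a ≤ P.D) (hc : 0 ≤ P.k * P.dn / P.n0)
    {i j l : ℤ} (hi : i - l ≠ 0) (hj : j - l ≠ 0) (p : ℝ × ℝ) : 0 ≤ P.coreIntegrand i j l p := by
  rw [coreIntegrand_eq_cladding ha hD hi hj]
  exact mul_nonneg (mul_nonneg hc (sq_nonneg _)) (indicator_nonneg
    (fun q _ => mul_nonneg (cladding_nonneg _ _ q) (cladding_nonneg _ _ q)) _)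

lemma summable_coreWeight (ha : 0 < P.a) (hD : 2 * P.a ≤ P.D) (hG : 0 < P.Gam) (i j : ℤ) :
    Summable (P.coreWeight i j) := by
  obtain ⟨C, hC⟩ := exists_abs_overlapSum_le ha hD hG
  refine Summable.of_norm_bounded_eventually (g := fun l : ℤ => |P.k * P.dn / P.n0 * P.B ^ 2| *
    (2 * Real.pi * (C * (1 / |((l : ℝ) - i) * ((l : ℝ) - j)|)))) ?_ ?_
  · exact (((summable_one_div_abs_mul_int i j).mul_left C).mul_left _).mul_left _
  -- The bound can fail only at the two exceptional indices `i` and `j`, where the weight is not an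
  -- overlap sum.
  · refine Set.Finite.subset (Set.toFinite {i, j}) fun l hl => ?_
    by_contra hij
    simp only [mem_insert_iff, mem_singleton_iff, not_or] at hij
    refine hl (show ‖P.coreWeight i j l‖ ≤ _ from ?_)
    have hi : i - l ≠ 0 := by omega
    have hj : j - l ≠ 0 := by omega
    have h := hC (i - l) (j - l) hi hj ((((i - l) * (j - l)).sign : ℤ) : ℝ) <| by
      rcases sign_cast_eq (mul_ne_zero hi hj) with h | h <;> rw [h] <;> simp
    rw [coreWeight, if_neg hj, if_neg hi, Real.norm_eq_abs, abs_mul, abs_mul (2 * Real.pi),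
      abs_of_pos Real.two_pi_pos]
    gcongr
    refine h.trans_eq ?_
    push_cast
    rw [show ((i : ℝ) - l) * (j - l) = (l - i) * (l - j) by ring]

/-- For `l ≠ i` the integrand is nonnegative, so the integral of its norm is the weight itself; the
single index `l = i` does not affect summability. -/
lemma summable_integral_norm_coreIntegrand (ha : 0 < P.a) (hD : 2 * P.a ≤ P.D) (hG : 0 < P.Gam)
    (hc : 0 ≤ P.k * P.dn / P.n0) (i j : ℤ) :
    Summable fun l : {l : ℤ // l ≠ j} => ∫ p, ‖P.coreIntegrand i j l p‖ := by
  refine (summable_congr_cofinite ?_).1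
    ((summable_coreWeight ha hD hG i j).comp_injective Subtype.val_injective)
  refine Set.Finite.subset ((Set.finite_singleton i).preimage Subtype.val_injective.injOn)
    fun l hl => ?_
  by_contra hi
  refine hl (show P.coreWeight i j l = ∫ p, ‖P.coreIntegrand i j l p‖ from ?_)
  have hi' : i - (l : ℤ) ≠ 0 := fun h => hi (by simp only [mem_preimage, mem_singleton_iff]; omega)
  have hj : j - (l : ℤ) ≠ 0 := fun h => l.2 (by omega)
  simp only [Real.norm_of_nonneg (coreIntegrand_nonneg ha hD hc hi' hj _)]
  exact (integral_coreIntegrand ha hD hG i hj).symm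

lemma integrable_kappaIntegrand (ha : 0 < P.a) (hD : 2 * P.a ≤ P.D) (hG : 0 < P.Gam)
    (hc : 0 ≤ P.k * P.dn / P.n0) (i j : ℤ) : Integrable (P.kappaIntegrand i j) := by
  rw [kappaIntegrand_eq_tsum]
  exact integrable_tsum_of_summable_integral_norm
    (fun l => integrable_coreIntegrand ha hD hG i (fun h => l.2 (by omega)))
    (summable_integral_norm_coreIntegrand ha hD hG hc i j)

lemma hasSum_coreWeight (ha : 0 < P.a) (hD : 2 * P.a ≤ P.D) (hG : 0 < P.Gam)
    (hc : 0 ≤ P.k * P.dn / P.n0) (i j : ℤ) : HasSum (P.coreWeight i j) (P.kappa i j) := by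
  have h := hasSum_integral_of_summable_integral_norm
    (fun l : {l : ℤ // l ≠ j} => integrable_coreIntegrand ha hD hG i
      (show j - (l : ℤ) ≠ 0 from fun h => l.2 (by omega)))
    (summable_integral_norm_coreIntegrand ha hD hG hc i j)
  rw [← kappaIntegrand_eq_tsum] at h
  have hsupp : Function.support (P.coreWeight i j) ⊆ {l : ℤ | l ≠ j} := by
    intro l hl hlj
    have hlj' : l = j := hlj
    exact hl (by rw [coreWeight, if_pos (by omega)])
  refine (hasSum_subtype_iff_of_support_subset hsupp).1 (h.congr_fun fun l => ?_)
  exact (integral_coreIntegrand ha hD hG i (fun h => l.2 (by omega))).symm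

/-! ### Reduction to `s = |i - j|` and the final sums -/

/-- `coreWeight`, with core `j` at the origin and core `i` at `s`. -/
noncomputable def relWeight (P : ArrayData) (s l : ℤ) : ℝ :=
  if l = 0 then 0
  else if l = s then 2 * Real.pi * P.k * P.dn / P.n0 * (P.A * P.B * P.tau s)
  else 2 * Real.pi * P.k * P.dn / P.n0 * (P.B ^ 2 *
    overlapSum P.Gam P.a (|(l : ℝ)| * P.D) (|(l : ℝ) - s| * P.D) ((l * (l - s)).sign : ℤ))

/-- Translation by `j`, combined with reflection when `ε = -1`, preserves all distances to core `l`
and the sign that tells whether core `l` separates the other two. -/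
lemma coreWeight_eq_relWeight (P : ArrayData) {i j s l ε : ℤ} (hε : ε = 1 ∨ ε = -1)
    (hs : 0 ≤ s) (hi : i = j + ε * s) : P.coreWeight i j (j + ε * l) = P.relWeight s l := by
  have h1 : j - (j + ε * l) = -ε * l := by ring
  have h2 : i - (j + ε * l) = ε * (s - l) := by rw [hi]; ring
  have hε0 : ε ≠ 0 := by rcases hε with rfl | rfl <;> norm_num
  have hεa : |(ε : ℝ)| = 1 := by rcases hε with rfl | rfl <;> norm_num
  have hε2 : ε * ε = 1 := by rcases hε with rfl | rfl <;> norm_num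
  have a1 : |((-ε * l : ℤ) : ℝ)| = |(l : ℝ)| := by
    push_cast; rw [abs_mul, abs_neg, hεa, one_mul]
  have a2 : |((ε * (s - l) : ℤ) : ℝ)| = |(l : ℝ) - s| := by
    push_cast; rw [abs_mul, hεa, one_mul, abs_sub_comm]
  have a3 : ε * (s - l) * (-ε * l) = l * (l - s) := by linear_combination (l * (l - s)) * hε2
  rw [coreWeight, relWeight, h1, h2, a1, a2, a3, overlapSum_comm]
  by_cases hl : l = 0
  · simp [hl]
  rw [if_neg (by simp [hε0, hl]), if_neg hl]
  by_cases hls : l = s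
  · subst hls
    rw [if_pos (by simp), if_pos rfl, tau, abs_of_nonneg (by exact_mod_cast hs), mul_assoc P.Gam]
    ring
  · rw [if_neg (by simp [hε0]; omega), if_neg hls]
    ring

lemma hasSum_relWeight (ha : 0 < P.a) (hD : 2 * P.a ≤ P.D) (hG : 0 < P.Gam)
    (hc : 0 ≤ P.k * P.dn / P.n0) {i j s : ℤ} (h : |i - j| = s) :
    HasSum (P.relWeight s) (P.kappa i j) := by
  have hs : 0 ≤ s := h ▸ abs_nonneg _
  have hw := hasSum_coreWeight ha hD hG hc i j
  rcases abs_choice (i - j) with h1 | h1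
  · refine ((Equiv.addLeft j).hasSum_iff.2 hw).congr_fun fun l => ?_
    have := coreWeight_eq_relWeight P (l := l) (j := j) (i := i) (.inl rfl) hs (by omega)
    rw [← this, one_mul]; rfl
  · refine ((Equiv.subLeft j).hasSum_iff.2 hw).congr_fun fun l => ?_
    have := coreWeight_eq_relWeight P (l := l) (j := j) (i := i) (.inr rfl) hs (by omega)
    rw [← this, Function.comp, Equiv.subLeft_apply]; congr 1; ring

lemma summable_varsigma (ha : 0 < P.a) (hD : 2 * P.a ≤ P.D) (hG : 0 < P.Gam) (s : ℤ)
    (S : Set ℤ) (hS : ∀ l ∈ S, l ≠ 0 ∧ l ≠ s) : Summable fun l : S => P.varsigma l s := by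
  obtain ⟨C, hC⟩ := exists_abs_overlapSum_le ha hD hG
  refine .of_norm_bounded (g := fun l : S => C * (1 / |((l : ℝ) - (0 : ℤ)) * ((l : ℝ) - s)|))
    (((summable_one_div_abs_mul_int 0 s).mul_left C).comp_injective Subtype.val_injective)
    fun l => ?_
  have h := hC l (l - s) (hS l l.2).1 (sub_ne_zero.2 (hS l l.2).2) 1 (by simp)
  push_cast at h
  rw [varsigma_eq, Real.norm_eq_abs]
  simpa using h

/-- Splits `ℤ` into `l < 0`, `0 ≤ l ≤ s` and `l > s`. On the two outer ranges `l(l - s) > 0`, so the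
weights are ς; the middle block stays unevaluated so that `s = 0` is covered as well. -/
lemma kappa_eq (ha : 0 < P.a) (hD : 2 * P.a ≤ P.D) (hG : 0 < P.Gam)
    (hc : 0 ≤ P.k * P.dn / P.n0) {i j s : ℤ} (h : |i - j| = s) :
    P.kappa i j = 2 * Real.pi * P.k * P.dn / P.n0 *
        (P.B ^ 2 * ∑' l : Set.Iio (0 : ℤ), P.varsigma l s) +
      ∑ l ∈ Finset.Icc 0 s, P.relWeight s l +
      2 * Real.pi * P.k * P.dn / P.n0 * (P.B ^ 2 * ∑' l : Set.Ioi s, P.varsigma l s) := by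
  have hs : 0 ≤ s := h ▸ abs_nonneg _
  have key (S : Set ℤ) (hS : ∀ l ∈ S, l ≠ 0 ∧ l ≠ s ∧ 0 < l * (l - s)) :
      HasSum (S.indicator (P.relWeight s)) (2 * Real.pi * P.k * P.dn / P.n0 *
        (P.B ^ 2 * ∑' l : S, P.varsigma l s)) := by
    rw [← hasSum_subtype_iff_indicator]
    refine (((summable_varsigma ha hD hG s S fun l hl =>
      ⟨(hS l hl).1, (hS l hl).2.1⟩).hasSum.mul_left
      (P.B ^ 2)).mul_left (2 * Real.pi * P.k * P.dn / P.n0)).congr_fun fun l => ?_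
    obtain ⟨h0, h1, h2⟩ := hS l l.2
    rw [Function.comp, relWeight, if_neg h0, if_neg h1, varsigma_eq, Int.sign_eq_one_of_pos h2,
      Int.cast_one]
  have h1 := key (Iio 0) fun l (hl : l < 0) =>
    ⟨by omega, by omega, mul_pos_of_neg_of_neg hl (by omega)⟩
  have h2 := key (Ioi s) fun l (hl : s < l) =>
    ⟨by omega, by omega, mul_pos (by omega) (by omega)⟩
  have h3 : HasSum ((Icc 0 s).indicator (P.relWeight s))
      (∑ l ∈ Finset.Icc 0 s, P.relWeight s l) := by
    have : HasSum ((Icc 0 s).indicator (P.relWeight s)) _ := hasSum_sum_of_ne_finset_zero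
      (s := Finset.Icc 0 s) fun l hl => indicator_of_notMem (by simpa using hl) _
    convert! this using 1
    exact Finset.sum_congr rfl fun l hl => (indicator_of_mem (by simpa using hl) _).symm
  refine (hasSum_relWeight ha hD hG hc h).unique (((h1.add h3).add h2).congr_fun fun l => ?_)
  rcases lt_or_ge l 0 with hl | hl
  · simp [hl, hl.not_ge, (hl.trans_le hs).le]
  · rcases le_or_gt l s with hls | hls
    · simp [hl, hls]
    · simp [hl, hls]

lemma sum_Icc_relWeight (P : ArrayData) {s : ℤ} (hs : 0 < s) :
    ∑ l ∈ Finset.Icc 0 s, P.relWeight s l = 2 * Real.pi * P.k * P.dn / P.n0 *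
      (P.A * P.B * P.tau s + P.B ^ 2 * ∑ l ∈ Finset.Icc (1 : ℤ) (s - 1), P.zeta l s) := by
  have e : Finset.Icc 0 s = insert 0 (insert s (Finset.Icc 1 (s - 1))) := by
    ext l; simp only [Finset.mem_insert, Finset.mem_Icc]; omega
  have hz : ∀ l ∈ Finset.Icc (1 : ℤ) (s - 1), P.relWeight s l =
      2 * Real.pi * P.k * P.dn / P.n0 * (P.B ^ 2 * P.zeta l s) := by
    intro l hl
    rw [Finset.mem_Icc] at hl
    rw [relWeight, if_neg (by omega), if_neg (by omega), zeta_eq,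
      Int.sign_eq_neg_one_of_neg (mul_neg_of_pos_of_neg (by omega) (by omega))]
    simp
  rw [e, Finset.sum_insert (by simp; omega), Finset.sum_insert (by simp), Finset.sum_congr rfl hz,
    ← Finset.mul_sum, ← Finset.mul_sum, relWeight, if_pos rfl, relWeight, if_neg hs.ne', if_pos rfl]
  ring

end ArrayData

end Waveguide

theorem mainTheorem5 (P : Waveguide.ArrayData)
    (ha : 0 < P.a) (hD : 2 * P.a ≤ P.D) (hn0 : 0 < P.n0) (hdn : 0 < P.dn) (hwl : 0 < P.wl)
    (hbeta0 : 0 < P.beta0) (hbeta0' : P.beta0 < P.k * P.dn / P.n0)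
    (hchar : P.CharacteristicEq) :
    -- the series in `m` defining `ς_{l,s}` and `ζ_{l,s}` are geometrically dominated
    (∀ l s : ℤ, l ≠ 0 → l ≠ s →
      P.a ^ 2 / (|(l : ℝ) * ((l : ℝ) - (s : ℝ))| * P.D ^ 2) < 1 ∧
      (∀ m : ℕ, 1 ≤ m →
        |P.term l s m| ≤ Real.exp (2 * P.Gam * P.a) * P.a ^ 2 / 8 *
          ((P.a ^ 2 / (|(l : ℝ) * ((l : ℝ) - (s : ℝ))| * P.D ^ 2)) ^ m / (m : ℝ) ^ 2)) ∧
      Summable (fun m : ℕ => P.term l s (m + 1)) ∧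
      Summable (fun m : ℕ => (-1 : ℝ) ^ (m + 1) * P.term l s (m + 1))) ∧
    -- the series over the cores converge
    (∀ s : ℤ, 0 ≤ s →
      Summable (fun l : Set.Iio (0 : ℤ) => P.varsigma l s) ∧
      Summable (fun l : Set.Ioi s => P.varsigma l s)) ∧
    -- the coupling coefficients exist and have the stated values
    (∀ i j : ℤ, MeasureTheory.Integrable (P.kappaIntegrand i j)) ∧
    (∀ i j s : ℤ, |i - j| = s → 0 < s →
      P.kappa i j = 2 * Real.pi * P.k * P.dn / P.n0 *
        (P.B ^ 2 * (∑' l : Set.Iio (0 : ℤ), P.varsigma l s)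
          + P.A * P.B * P.tau s
          + P.B ^ 2 * (∑ l ∈ Finset.Icc (1 : ℤ) (s - 1), P.zeta l s)
          + P.B ^ 2 * (∑' l : Set.Ioi s, P.varsigma l s))) ∧
    (∀ i : ℤ,
      P.kappa i i = 2 * Real.pi * P.B ^ 2 * P.k * P.dn / P.n0 *
        ((∑' l : Set.Iio (0 : ℤ), P.varsigma l 0)
          + ∑' l : Set.Ioi (0 : ℤ), P.varsigma l 0)) := by
  have hG := Waveguide.ArrayData.Gam_pos hn0 hwl hbeta0
  have hc : 0 ≤ P.k * P.dn / P.n0 := by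
    have := Waveguide.ArrayData.k_pos hn0 hwl
    positivity
  refine ⟨fun l s hl hls => ?_, fun s hs => ⟨?_, ?_⟩,
    Waveguide.ArrayData.integrable_kappaIntegrand ha hD hG hc, fun i j s h hs => ?_, fun i => ?_⟩
  · have hls' : l - s ≠ 0 := sub_ne_zero.2 hls
    have h1 := Waveguide.ArrayData.two_mul_a_le ha hD hl
    have h2 := Waveguide.ArrayData.two_mul_a_le ha hD hls'
    have hq := Waveguide.ArrayData.ratio_lt_one ha hD hl hls'
    push_cast at h2 hq
    have hd1 : 0 < |(l : ℝ)| * P.D := by linarith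
    have hd2 : 0 < |(l : ℝ) - s| * P.D := by linarith
    have hsum : Summable fun m : ℕ => P.term l s (m + 1) := by
      simp only [Waveguide.ArrayData.term_eq]
      exact Waveguide.summable_overlapTerm_succ hG ha hd1 hd2 hq.le
    refine ⟨by rwa [← Waveguide.ArrayData.ratio_eq], fun m hm => ?_, hsum,
      .of_norm_bounded hsum.abs fun m => by simp⟩
    obtain ⟨n, rfl⟩ := Nat.exists_eq_add_of_le' hm
    rw [Waveguide.ArrayData.term_eq, abs_of_nonneg (Waveguide.overlapTerm_nonneg _ ha _ _ _),
      ← Waveguide.ArrayData.ratio_eq]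
    exact Waveguide.overlapTerm_succ_le hG ha hd1 hd2 n
  · exact Waveguide.ArrayData.summable_varsigma ha hD hG s _ fun l (hl : l < 0) =>
      ⟨by omega, by omega⟩
  · exact Waveguide.ArrayData.summable_varsigma ha hD hG s _ fun l (hl : s < l) =>
      ⟨by omega, by omega⟩
  · rw [Waveguide.ArrayData.kappa_eq ha hD hG hc h, Waveguide.ArrayData.sum_Icc_relWeight P hs]
    ring
  -- For `s = 0` the middle block is the single core `l = 0`, whose weight is `0` because `l = j` is
  -- excluded.
  · rw [Waveguide.ArrayData.kappa_eq ha hD hG hc (s := 0) (by simp)]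
    simp only [Finset.Icc_self, Finset.sum_singleton, Waveguide.ArrayData.relWeight, if_pos]
    ring
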